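/- Let $1<\alpha\le 2$, $N\ge 0$, $a(0),\dots,a(N)\in\mathbb C$, and put $A_N(e^{i\theta})=\sum_{j=0}^N a(j)e^{ij\theta}$, and $z^{\langle\beta\rangle}=|z|^{\beta-1}\bar z$ for $z\in\mathbb C$, $\beta>0$. A harmonizable symmetric $\alpha$-stable sequence with spectral density $f$ is a sequence $\xi(n)=\int_{-\pi}^{\pi}e^{in\theta}\,dZ(\theta)$, $n\in\mathbb Z$, where $Z$ is a complex symmetric $\alpha$-stable process with independent increments and $\|Z(t)-Z(s)\|_\alpha^\alpha=\int_s^t f(\theta)\,d\theta$, and $\|\cdot\|_\alpha$ is the covariation norm ($\|X\|_\alpha^\alpha=[X,X]_\alpha$, the total mass of the spectral measure of $X$ on the unit circle). The functional $A_N\xi=\sum_{j=0}^N a(j)\xi(j)$ is to be estimated linearly from $\xi(j)$, $j\in\mathbb Z\setminus\{0,\dots,N\}$. For a spectral density $f\ge 0$ (integrable on $[-\pi,\pi]$) let $L_N^\alpha(f)$ be the closed span of $\{e^{ij\theta}: j\in\mathbb Z\setminus\{0,\dots,N\}\}$ in $L^\alpha(f\,d\theta)$, and let $$\Delta(h;f)=\int_{-\pi}^{\pi}|A_N(e^{i\theta})-h(\theta)|^\alpha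 f(\theta)\,d\theta .$$ Let $h(f)$ denote the minimizer of $\Delta(\cdot\,;f)$ over $L_N^\alpha(f)$ (the spectral characteristic of the optimal estimate), so that $\Delta(h(f);f)=\min_{h\in L_N^\alpha(f)}\Delta(h;f)$. For a class $D$ of spectral densities, $f_0\in D$ is called least favorable if $\Delta(h(f_0);f_0)=\max_{f\in D}\Delta(h(f);f)$, and $h^0$ is called a minimax spectral characteristic if $h^0\in H_D=\bigcap_{f\in D}L_N^\alpha(f)$ and $\max_{f\in D}\Delta(h^0;f)=\min_{h\in H_D}\sup_{f\in D}\Delta(h;f)$. Theorem. Let $P\in\mathbb R$ and $D_f^0=\{f:\int_{-\pi}^{\pi}f(\theta)\,d\theta=P\}$. Suppose that, for some $C\in\mathbb R$ and $c(0),\dots,c(N)\in\mathbb C$, the function $$f_0(\theta)=C\Bigl|\sum_{j=0}^N c(j)e^{-ij\theta}\Bigr|\quad\text{(for a.e. }\theta\in[-\pi,\pi])$$ is a spectral density in $D_f^0$, satisfies the minimality condition $\int_{-\pi}^{\pi}f_0(\theta)^{-1/(\alpha-1)}\,d\theta<\infty$, and satisfies $$\int_{-\pi}^{\pi}e^{-ik\theta}\Bigl[\sum_{j=0}^N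 a(j)e^{ij\theta}-\Bigl(f_0(\theta)^{-1}\sum_{j=0}^N c(j)e^{-ij\theta}\Bigr)^{\langle 1/(\alpha-1)\rangle}\Bigr]d\theta=0,\qquad k=0,\dots,N.$$ Then: 1. the spectral characteristic $h(f_0)$ exists, is unique up to equality a.e. with respect to $f_0\,d\theta$, and is $$h(f_0)(\theta)=A_N(e^{i\theta})-\Bigl(f_0(\theta)^{-1}\sum_{j=0}^N c(j)e^{-ij\theta}\Bigr)^{\langle 1/(\alpha-1)\rangle};$$ 2. $f_0$ is least favorable in $D_f^0$; 3. $h(f_0)$ is a minimax spectral characteristic for $D_f^0$ (in particular it lies in $H_{D_f^0}$). Here $\Delta(h;f)$ is indeed the error of estimation: if $\xi$ is a harmonizable symmetric $\alpha$-stable sequence with spectral density $f\in D_f^0$, $h\in L_N^\alpha(f)$, and $\eta$ is the linear estimate with spectral characteristic $h$ (that is, $\eta=\int_{-\pi}^{\pi}h\,dZ$, a limit in probability of finite linear combinations of the $\xi(j)$, $j\notin\{0,\dots,N\}$, whose images under $\xi(j)\leftrightarrow e^{ij\theta}$ converge to $h$ in $L^\alpha(f\,d\theta)$), then $A_N\xi-\eta$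 is symmetric $\alpha$-stable and $\|A_N\xi-\eta\|_\alpha^\alpha=\Delta(h;f)$. -/

import Mathlib

open MeasureTheory ProbabilityTheory Filter Topology
open scoped ENNReal ComplexConjugate

noncomputable section

namespace StableInterpolation

/-! ### Symmetric stable random variables and sequences -/

/-- `Γ` is the spectral measure of the complex symmetric `α`-stable random variable `X`: a finite
symmetric measure on the unit circle with
`E exp(i⟨X, w⟩) = exp(-∫ |⟨s, w⟩|^α dΓ(s))` for all `w`, where `⟨·, ·⟩` is the inner product of
`ℂ = ℝ²`. -/
structure HasStableSpectralMeasure {Ω : Type*} [MeasurableSpace Ω] (α : ℝ) (Pr : Measure Ω)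
    (X : Ω → ℂ) (Γ : Measure (Metric.sphere (0 : ℂ) 1)) : Prop where
  aemeasurable : AEMeasurable X Pr
  finite : IsFiniteMeasure Γ
  symmetric : Γ.map (fun s => -s) = Γ
  charFun_eq : ∀ w : ℂ, charFun (Pr.map X) w =
    Complex.exp (-((∫ s, |inner ℝ (s : ℂ) w| ^ α ∂Γ : ℝ) : ℂ))

/-- `X` is complex symmetric `α`-stable and `‖X‖_α^α = [X, X]_α = v`. As
`[X, X]_α = ∫ s s^{<α-1>} dΓ(s)` and `|s| = 1` on the circle, this is the total mass of the spectral
measure of `X`. -/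
def HasCovariationNormPow {Ω : Type*} [MeasurableSpace Ω] (α : ℝ) (Pr : Measure Ω)
    (X : Ω → ℂ) (v : ℝ≥0∞) : Prop :=
  ∃ Γ : Measure (Metric.sphere (0 : ℂ) 1), HasStableSpectralMeasure α Pr X Γ ∧ Γ Set.univ = v

/-- The absolutely continuous measure `f(θ) dθ` on `(-π, π]`. -/
def spectralMeasure (f : ℝ → ℝ) : Measure ℝ :=
  (volume.restrict (Set.Ioc (-Real.pi) Real.pi)).withDensity (fun θ => ENNReal.ofReal (f θ))

/-- The Riemann-Stieltjes sum of `g` over the partition of `[-π, π]` into `m` equal parts, with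
respect to the process `Z`. -/
def stieltjesSum {Ω : Type*} (Z : ℝ → Ω → ℂ) (g : ℝ → ℂ) (m : ℕ) (ω : Ω) : ℂ :=
  ∑ k ∈ Finset.range m,
    g (-Real.pi + 2 * Real.pi * k / m) *
      (Z (-Real.pi + 2 * Real.pi * (k + 1) / m) ω - Z (-Real.pi + 2 * Real.pi * k / m) ω)

/-- `ξ` is a harmonizable symmetric `α`-stable sequence with spectral density `f`:
`ξ(n) = ∫_{-π}^{π} e^{inθ} dZ(θ)` (a limit in probability of Riemann-Stieltjes sums) for a complex
symmetric `α`-stable process `Z` with independent increments whose spectral measure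
`μ((s, t]) = ‖Z(t) - Z(s)‖_α^α` has the density `f` on `(-π, π]` (and no mass elsewhere). -/
def IsHarmonizableStable {Ω : Type*} [MeasurableSpace Ω] (α : ℝ) (Pr : Measure Ω)
    (ξ : ℤ → Ω → ℂ) (f : ℝ → ℝ) : Prop :=
  ∃ Z : ℝ → Ω → ℂ,
    (∀ᵐ ω ∂Pr, Z (-Real.pi) ω = 0) ∧
    HasIndepIncrements Z Pr ∧
    (∀ s t : ℝ, s ≤ t →
      HasCovariationNormPow α Pr (fun ω => Z t ω - Z s ω) (spectralMeasure f (Set.Ioc s t))) ∧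
    ∀ n : ℤ, TendstoInMeasure Pr
      (fun m => stieltjesSum Z (fun θ => Complex.exp (n * θ * Complex.I)) m) atTop (ξ n)

/-! ### The spectral domain -/

/-- `∑_j b(j) e^{ijθ}` for finitely supported `b`. -/
def trigSum (b : ℤ →₀ ℂ) (θ : ℝ) : ℂ :=
  b.sum fun j z => z * Complex.exp (j * θ * Complex.I)

/-- `b` does not use the unobserved times `0, …, N`. -/
def IsObserved (N : ℕ) (b : ℤ →₀ ℂ) : Prop :=
  ∀ j ∈ b.support, j ∉ Set.Icc (0 : ℤ) N

/-- `L_N^α(f)`: the closed subspace of `L^α(f dθ)` generated by the functions `e^{ijθ}`,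
`j ∈ ℤ ∖ {0, …, N}`. -/
def observedSpace (α : ℝ) (N : ℕ) (f : ℝ → ℝ) : Set (ℝ → ℂ) :=
  {h | MemLp h (ENNReal.ofReal α) (spectralMeasure f) ∧
    ∀ ε : ℝ≥0∞, 0 < ε → ∃ b : ℤ →₀ ℂ, IsObserved N b ∧
      eLpNorm (fun θ => h θ - trigSum b θ) (ENNReal.ofReal α) (spectralMeasure f) < ε}

/-- `A_N(e^{iθ}) = ∑_{j=0}^N a(j) e^{ijθ}`. -/
def polyA (N : ℕ) (a : ℕ → ℂ) (θ : ℝ) : ℂ :=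
  ∑ j ∈ Finset.range (N + 1), a j * Complex.exp (j * θ * Complex.I)

/-- `C_N(e^{iθ}) = ∑_{j=0}^N c(j) e^{-ijθ}`. -/
def polyC (N : ℕ) (c : ℕ → ℂ) (θ : ℝ) : ℂ :=
  ∑ j ∈ Finset.range (N + 1), c j * Complex.exp (-(j * θ * Complex.I))

/-- `z^{<β>} = |z|^{β-1} z̄`. -/
def signedPow (z : ℂ) (β : ℝ) : ℂ := ((‖z‖ ^ (β - 1) : ℝ) : ℂ) * conj z

/-- `A_N(e^{iθ}) - (f(θ)⁻¹ C_N(e^{iθ}))^{<1/(α-1)>}`. -/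
def spectralCharacteristic (α : ℝ) (N : ℕ) (a c : ℕ → ℂ) (f : ℝ → ℝ) (θ : ℝ) : ℂ :=
  polyA N a θ - signedPow (((f θ)⁻¹ : ℝ) * polyC N c θ) (1 / (α - 1))

/-- The minimality condition `∫_{-π}^{π} f(θ)^{-1/(α-1)} dθ < ∞`, with value `+∞` of the
integrand where `f` vanishes. -/
def Minimality (α : ℝ) (f : ℝ → ℝ) : Prop :=
  ∫⁻ θ in Set.Ioc (-Real.pi) Real.pi, ENNReal.ofReal (f θ) ^ (-1 / (α - 1)) < ∞

/-- The error `Δ(h; f) = ∫_{-π}^{π} |A_N(e^{iθ}) - h(θ)|^α f(θ) dθ`. -/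
def estError (α : ℝ) (N : ℕ) (a : ℕ → ℂ) (h : ℝ → ℂ) (f : ℝ → ℝ) : ℝ≥0∞ :=
  ∫⁻ θ, ‖polyA N a θ - h θ‖ₑ ^ α ∂(spectralMeasure f)

/-- `h = h(f)`: `h` is the best approximation of `A_N(e^{iθ})` in `L_N^α(f)`, i.e. the spectral
characteristic of the optimal linear estimate when the spectral density is `f`. -/
def IsOptimalCharacteristic (α : ℝ) (N : ℕ) (a : ℕ → ℂ) (f : ℝ → ℝ) (h : ℝ → ℂ) : Prop :=
  h ∈ observedSpace α N f ∧ ∀ g ∈ observedSpace α N f, estError α N a h f ≤ estError α N a g f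

/-- The error `Δ(h(f); f)` of the optimal linear estimate when the spectral density is `f`. -/
def optimalError (α : ℝ) (N : ℕ) (a : ℕ → ℂ) (f : ℝ → ℝ) : ℝ≥0∞ :=
  ⨅ h ∈ observedSpace α N f, estError α N a h f

/-! ### Minimax notions -/

/-- The class of spectral densities on `(-π, π]` with `∫_{-π}^{π} f(θ) dθ = P`. -/
def densityClass (P : ℝ) : Set (ℝ → ℝ) :=
  {f | IntegrableOn f (Set.Ioc (-Real.pi) Real.pi) ∧
    (∀ᵐ θ ∂(volume.restrict (Set.Ioc (-Real.pi) Real.pi)), 0 ≤ f θ) ∧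
    ∫ θ in Set.Ioc (-Real.pi) Real.pi, f θ = P}

/-- `f₀` is least favorable in `D`: `f₀ ∈ D`, `h(f₀)` exists and
`Δ(h(f₀); f₀) = max_{f ∈ D} Δ(h(f); f)`. -/
def IsLeastFavorable (α : ℝ) (N : ℕ) (a : ℕ → ℂ) (D : Set (ℝ → ℝ)) (f₀ : ℝ → ℝ) : Prop :=
  f₀ ∈ D ∧ (∃ h, IsOptimalCharacteristic α N a f₀ h) ∧
    ∀ f ∈ D, optimalError α N a f ≤ optimalError α N a f₀

/-- `H_D = ⋂_{f ∈ D} L_N^α(f)`. -/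
def minimaxSpace (α : ℝ) (N : ℕ) (D : Set (ℝ → ℝ)) : Set (ℝ → ℂ) :=
  ⋂ f ∈ D, observedSpace α N f

/-- `h₀` is a minimax (robust) spectral characteristic for `D`: `h₀ ∈ H_D`, the maximum of
`Δ(h₀; f)` over `f ∈ D` is attained, and
`max_{f ∈ D} Δ(h₀; f) = min_{h ∈ H_D} sup_{f ∈ D} Δ(h; f)`. -/
def IsMinimaxCharacteristic (α : ℝ) (N : ℕ) (a : ℕ → ℂ) (D : Set (ℝ → ℝ)) (h₀ : ℝ → ℂ) : Prop :=
  h₀ ∈ minimaxSpace α N D ∧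
    (∃ f₁ ∈ D, ∀ f ∈ D, estError α N a h₀ f ≤ estError α N a h₀ f₁) ∧
    ∀ h ∈ minimaxSpace α N D, (⨆ f ∈ D, estError α N a h₀ f) ≤ (⨆ f ∈ D, estError α N a h f)

/-! ### Linear estimates of `A_N ξ` -/

/-- The functional `A_N ξ = ∑_{j=0}^N a(j) ξ(j)`. -/
def functionalA {Ω : Type*} (N : ℕ) (a : ℕ → ℂ) (ξ : ℤ → Ω → ℂ) (ω : Ω) : ℂ :=
  ∑ j ∈ Finset.range (N + 1), a j * ξ j ω

/-- `η` is the linear estimate with spectral characteristic `h`, based on the values `ξ(j)`,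
`j ∈ ℤ ∖ {0, …, N}`, of a sequence with spectral density `f`. That is, `η` corresponds to `h` under
the isomorphism `ξ(j) ↔ e^{ijθ}`: it is the limit in probability of finite linear combinations of
observed values whose spectral counterparts converge to `h` in `L^α(f dθ)`. -/
def IsLinearEstimate {Ω : Type*} [MeasurableSpace Ω] (α : ℝ) (N : ℕ) (Pr : Measure Ω)
    (ξ : ℤ → Ω → ℂ) (f : ℝ → ℝ) (h : ℝ → ℂ) (η : Ω → ℂ) : Prop :=
  ∃ b : ℕ → ℤ →₀ ℂ, (∀ n, IsObserved N (b n)) ∧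
    Tendsto (fun n => eLpNorm (fun θ => h θ - trigSum (b n) θ) (ENNReal.ofReal α)
      (spectralMeasure f)) atTop (𝓝 0) ∧
    TendstoInMeasure Pr (fun n ω => (b n).sum fun j z => z * ξ j ω) atTop η

end StableInterpolation

end

/-! Put `K = C ^ (-1/(α-1))`. Since `f₀ = C |C_N|`, the difference `A_N - h(f₀)` is `K` times the
conjugate of the phase `u = C_N / |C_N|`; it has constant modulus `K`, so `Δ(h(f₀); f) = K ^ α * P`
for every `f` in the class: `h(f₀)` is an equalizer. On the other hand `f₀ u = C C_N` has only the
frequencies `0, …, -N`, so `∫ g u f₀ = 0` for `g` in `L_N^α(f₀)`, and the mean of `(A_N - g) u` with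
respect to `f₀ dθ` is the same constant `K` for all these `g`. As `z ↦ |z| ^ α` is strictly convex,
Jensen's inequality shows that `g = h(f₀)`, for which `(A_N - g) u` is constant, is the unique best
approximation. Optimality at `f₀` and the equalizer property form a saddle point, which makes `f₀`
least favorable and `h(f₀)` minimax. That `h(f₀)` lies in `L_N^α(f)` for every `f` of the class
follows by approximating it by a trigonometric polynomial in `L^α(dθ + f dθ)`: its Fourier
coefficients at `0, …, N` vanish, so those of the polynomial are small and can be deleted.

For the error formula, the covariation norm of a stochastic integral is computed on Riemann sums,
where the increments are independent; sums of independent stable variables add the spectral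
measures, and limits in probability are handled by compactness of the finite measures on the
circle. -/

namespace StableInterpolation

/-! ### Complex symmetric stable random variables -/

section Stable

variable {Ω : Type*} [MeasurableSpace Ω] {α : ℝ} {Pr : Measure Ω}

lemma continuous_abs_inner_rpow {E : Type*} [SeminormedAddCommGroup E] [InnerProductSpace ℝ E]
    (hα : 0 ≤ α) (A : Set E) (w : E) : Continuous fun s : A => |inner ℝ (s : E) w| ^ α :=
  (by fun_prop : Continuous fun s : A => |inner ℝ (s : E) w|).rpow_const fun _ => Or.inr hα

lemma charFun_map_const_mul {X : Ω → ℂ} (hX : AEMeasurable X Pr) (z w : ℂ) :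
    charFun (Pr.map fun ω => z * X ω) w = charFun (Pr.map X) (conj z * w) := by
  rw [charFun_apply, charFun_apply, integral_map (by fun_prop) (by fun_prop),
    integral_map (by fun_prop) (by fun_prop)]
  congr with ω
  congr 3
  simp only [Complex.inner, map_mul, Complex.mul_re, Complex.conj_re, Complex.conj_im,
    Complex.mul_im]
  ring

namespace HasStableSpectralMeasure

variable {X : Ω → ℂ} {Γ : Measure (Metric.sphere (0 : ℂ) 1)}

lemma circle_mul (hα : 0 ≤ α) (h : HasStableSpectralMeasure α Pr X Γ)
    (u : Metric.sphere (0 : ℂ) 1) :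
    HasStableSpectralMeasure α Pr (fun ω => u * X ω) (Γ.map (u * ·)) where
  aemeasurable := h.aemeasurable.const_mul _
  finite := have := h.finite; inferInstance
  symmetric := by
    rw [Measure.map_map (by fun_prop) (by fun_prop)]
    conv_rhs => rw [← h.symmetric, Measure.map_map (by fun_prop) (by fun_prop)]
    congr 1 with s
    simp
  charFun_eq w := by
    rw [charFun_map_const_mul h.aemeasurable, h.charFun_eq, integral_map (by fun_prop)
      (continuous_abs_inner_rpow hα _ w).aestronglyMeasurable]
    congr! 6 with s
    simp only [Complex.inner, Metric.unitSphere.coe_mul, map_mul]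
    ring_nf

lemma ofReal_mul (h : HasStableSpectralMeasure α Pr X Γ) {r : ℝ} (hr : 0 ≤ r) :
    HasStableSpectralMeasure α Pr (fun ω => r * X ω) (ENNReal.ofReal (r ^ α) • Γ) where
  aemeasurable := h.aemeasurable.const_mul _
  finite := have := h.finite; Measure.smul_finite _ (by simp)
  symmetric := by rw [Measure.map_smul, h.symmetric]
  charFun_eq w := by
    rw [charFun_map_const_mul h.aemeasurable, h.charFun_eq, integral_smul_measure,
      ENNReal.toReal_ofReal (by positivity), smul_eq_mul, ← integral_const_mul, Complex.conj_ofReal,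
      ← Complex.real_smul]
    simp only [real_inner_smul_right, abs_mul, abs_of_nonneg hr, Real.mul_rpow hr (abs_nonneg _)]

lemma sum (hα : 0 ≤ α) {ι : Type*} (s : Finset ι) {X : ι → Ω → ℂ}
    {Γ : ι → Measure (Metric.sphere (0 : ℂ) 1)} (hindep : iIndepFun X Pr)
    (h : ∀ i, HasStableSpectralMeasure α Pr (X i) (Γ i)) :
    HasStableSpectralMeasure α Pr (fun ω => ∑ i ∈ s, X i ω) (∑ i ∈ s, Γ i) := by
  have hfin := fun i => (h i).finite
  refine ⟨Finset.aemeasurable_fun_sum s fun i _ => (h i).aemeasurable, inferInstance, ?_,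
    fun w => ?_⟩
  · simp only [← Measure.mapₗ_apply_of_measurable measurable_neg, map_sum]
    simp only [Measure.mapₗ_apply_of_measurable measurable_neg, (h _).symmetric]
  · have hint : ∀ i ∈ s, Integrable (fun x : Metric.sphere (0 : ℂ) 1 => |inner ℝ (x : ℂ) w| ^ α)
        (Γ i) := fun i _ =>
      (continuous_abs_inner_rpow hα _ w).integrable_of_hasCompactSupport
        (HasCompactSupport.of_compactSpace _)
    rw [(hindep.restrict _).charFun_map_fun_finsetSum_eq_prod fun i _ => (h i).aemeasurable,
      Finset.prod_apply, Finset.prod_congr rfl fun i _ => (h i).charFun_eq w,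
      ← Complex.exp_sum, integral_finsetSum_measure hint, Complex.ofReal_sum,
      Finset.sum_neg_distrib]

lemma of_tendsto [IsProbabilityMeasure Pr] (hα : 0 ≤ α) {X : ℕ → Ω → ℂ} {Y : Ω → ℂ}
    {Γ : ℕ → FiniteMeasure (Metric.sphere (0 : ℂ) 1)}
    {ν : FiniteMeasure (Metric.sphere (0 : ℂ) 1)} {l : Filter ℕ} [l.NeBot] (hl : l ≤ atTop)
    (h : ∀ n, HasStableSpectralMeasure α Pr (X n) (Γ n)) (hX : TendstoInMeasure Pr X atTop Y)
    (hΓ : Tendsto Γ l (𝓝 ν)) : HasStableSpectralMeasure α Pr Y ν := by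
  have hint : ∀ g : Metric.sphere (0 : ℂ) 1 → ℝ, Continuous g →
      Tendsto (fun n => ∫ s, g s ∂(Γ n : Measure _)) l (𝓝 (∫ s, g s ∂(ν : Measure _))) :=
    fun g hg => FiniteMeasure.tendsto_iff_forall_integral_tendsto.1 hΓ
      (BoundedContinuousFunction.mkOfCompact ⟨g, hg⟩)
  refine ⟨hX.aemeasurable fun n => (h n).aemeasurable, inferInstance, ?_, fun w => ?_⟩
  · refine ext_of_forall_integral_eq_of_IsFiniteMeasure fun g => ?_
    rw [integral_map (by fun_prop) (by fun_prop)]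
    refine tendsto_nhds_unique (hint (fun s => g (-s)) (by fun_prop)) ?_
    refine (hint g g.continuous).congr fun n => ?_
    conv_lhs => rw [← (h n).symmetric]
    rw [integral_map (by fun_prop) (by fun_prop)]
  · have hchar := ProbabilityMeasure.tendsto_iff_tendsto_charFun.1
      (hX.tendstoInDistribution fun n => (h n).aemeasurable).tendsto w
    have hexp := ((Complex.continuous_ofReal.tendsto _).comp
      (hint _ (continuous_abs_inner_rpow hα _ w))).neg.cexp
    exact tendsto_nhds_unique (hchar.mono_left hl) (hexp.congr fun n => ((h n).charFun_eq w).symm)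

end HasStableSpectralMeasure

lemma exists_ultrafilter_tendsto_finiteMeasure {E : Type*} [TopologicalSpace E] [T2Space E]
    [MeasurableSpace E] [BorelSpace E] [CompactSpace E] {Γ : ℕ → FiniteMeasure E}
    {v : ℝ≥0∞} (hv : v ≠ ∞) (hΓ : Tendsto (fun n => (Γ n : Measure E) Set.univ) atTop (𝓝 v)) :
    ∃ U : Ultrafilter ℕ, ↑U ≤ (atTop : Filter ℕ) ∧ ∃ ν : FiniteMeasure E,
      Tendsto Γ U (𝓝 ν) ∧ (ν : Measure E) Set.univ = v := by
  simp only [← FiniteMeasure.ennreal_mass] at hΓ ⊢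
  have hbound : ∀ᶠ n in atTop, (Γ n).mass ≤ (v + 1).toNNReal := by
    filter_upwards [hΓ.eventually_lt_const (ENNReal.lt_add_right hv one_ne_zero)] with n hn
    rw [← ENNReal.coe_le_coe, ENNReal.coe_toNNReal (by finiteness)]
    exact hn.le
  have hU := Ultrafilter.of_le (atTop : Filter ℕ)
  obtain ⟨ν, -, hν⟩ := (isCompact_setOfPred_finiteMeasure_le_of_compactSpace E
    (v + 1).toNNReal).ultrafilter_le_nhds ((Ultrafilter.of atTop).map Γ)
    (le_principal_iff.2 (hU hbound))
  exact ⟨_, hU, ν, hν, tendsto_nhds_unique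
    (ENNReal.tendsto_coe.2 ((FiniteMeasure.continuous_mass.tendsto ν).comp hν)) (hΓ.mono_left hU)⟩

lemma HasCovariationNormPow.const_mul (hα : 0 ≤ α) {X : Ω → ℂ} {v : ℝ≥0∞}
    (h : HasCovariationNormPow α Pr X v) (z : ℂ) :
    HasCovariationNormPow α Pr (fun ω => z * X ω) (‖z‖ₑ ^ α * v) := by
  obtain ⟨Γ, hΓ, rfl⟩ := h
  obtain ⟨u, hu, huz⟩ := Complex.exists_norm_mul_eq_self z
  lift u to Metric.sphere (0 : ℂ) 1 using by simpa using hu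
  refine ⟨(ENNReal.ofReal (‖z‖ ^ α) • Γ).map (u * ·), ?_, ?_⟩
  · have hpolar : (fun ω => z * X ω) = fun ω => u * ((‖z‖ : ℂ) * X ω) := by
      simp only [← mul_assoc, huz]
    rw [hpolar]
    exact (hΓ.ofReal_mul (norm_nonneg z)).circle_mul hα u
  · rw [Measure.map_apply (by fun_prop) .univ, Set.preimage_univ, Measure.smul_apply, smul_eq_mul,
      ← ENNReal.ofReal_rpow_of_nonneg (norm_nonneg z) hα, ofReal_norm]

lemma HasCovariationNormPow.sum (hα : 0 ≤ α) {ι : Type*} (s : Finset ι) {X : ι → Ω → ℂ}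
    {v : ι → ℝ≥0∞} (hindep : iIndepFun X Pr) (h : ∀ i, HasCovariationNormPow α Pr (X i) (v i)) :
    HasCovariationNormPow α Pr (fun ω => ∑ i ∈ s, X i ω) (∑ i ∈ s, v i) := by
  choose Γ hΓ hmass using h
  exact ⟨∑ i ∈ s, Γ i, .sum hα s hindep hΓ, by simp [hmass]⟩

lemma HasCovariationNormPow.of_tendstoInMeasure [IsProbabilityMeasure Pr] (hα : 0 ≤ α)
    {X : ℕ → Ω → ℂ} {Y : Ω → ℂ} {v : ℕ → ℝ≥0∞} {v' : ℝ≥0∞} (hv' : v' ≠ ∞)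
    (hv : Tendsto v atTop (𝓝 v')) (h : ∀ n, HasCovariationNormPow α Pr (X n) (v n))
    (hX : TendstoInMeasure Pr X atTop Y) : HasCovariationNormPow α Pr Y v' := by
  choose Γ hΓ hmass using h
  obtain ⟨U, hU, ν, hν, hνv⟩ := exists_ultrafilter_tendsto_finiteMeasure
    (Γ := fun n => ⟨Γ n, (hΓ n).finite⟩) hv' (hv.congr fun n => (hmass n).symm)
  exact ⟨ν, .of_tendsto hα hU hΓ hX hν, hνv⟩

end Stable

/-! ### Linear operations on limits in measure -/

section TendstoInMeasure

variable {Ω ι κ E : Type*} [MeasurableSpace Ω] [SeminormedAddCommGroup E] {μ : Measure Ω}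
  {l : Filter ι}

lemma tendstoInMeasure_const (X : Ω → E) : TendstoInMeasure μ (fun _ : ι => X) l X := by
  intro ε hε
  simpa [hε.ne'] using tendsto_const_nhds

lemma tendstoInMeasure_add {X Y : ι → Ω → E} {X' Y' : Ω → E}
    (hX : TendstoInMeasure μ X l X') (hY : TendstoInMeasure μ Y l Y') :
    TendstoInMeasure μ (fun n ω => X n ω + Y n ω) l (fun ω => X' ω + Y' ω) := by
  rw [tendstoInMeasure_iff_norm] at *
  intro ε hε
  have hlim := (hX (ε / 2) (by positivity)).add (hY (ε / 2) (by positivity))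
  rw [add_zero] at hlim
  refine tendsto_of_tendsto_of_tendsto_of_le_of_le tendsto_const_nhds hlim (fun _ => zero_le)
    fun n => (measure_mono fun ω hω => ?_).trans (measure_union_le _ _)
  by_contra hcon
  simp only [Set.mem_union, Set.mem_ofPred_eq, not_or, not_le] at hcon hω
  have htri := norm_add_le (X n ω - X' ω) (Y n ω - Y' ω)
  rw [sub_add_sub_comm] at htri
  linarith [hcon.1, hcon.2]

lemma tendstoInMeasure_const_smul {𝕜 : Type*} [NormedField 𝕜] [NormedSpace 𝕜 E] {X : ι → Ω → E}
    {X' : Ω → E} (z : 𝕜) (hX : TendstoInMeasure μ X l X') :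
    TendstoInMeasure μ (fun n ω => z • X n ω) l (fun ω => z • X' ω) := by
  rcases eq_or_ne z 0 with rfl | hz
  · simpa using tendstoInMeasure_const (μ := μ) (l := l) fun _ : Ω => (0 : E)
  rw [tendstoInMeasure_iff_norm] at *
  intro ε hε
  have hz' : 0 < ‖z‖ := norm_pos_iff.2 hz
  convert! hX (ε / ‖z‖) (by positivity) using 5 with n ω
  rw [← smul_sub, norm_smul, div_le_iff₀' hz']

lemma tendstoInMeasure_sum {X : κ → ι → Ω → E} {X' : κ → Ω → E} (s : Finset κ)
    (hX : ∀ k ∈ s, TendstoInMeasure μ (X k) l (X' k)) :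
    TendstoInMeasure μ (fun n ω => ∑ k ∈ s, X k n ω) l (fun ω => ∑ k ∈ s, X' k ω) := by
  classical
  induction s using Finset.induction_on with
  | empty => simpa using tendstoInMeasure_const (μ := μ) (l := l) fun _ : Ω => (0 : E)
  | insert k s hk ih =>
    simp only [Finset.sum_insert hk]
    exact tendstoInMeasure_add (hX k (by simp)) (ih fun j hj => hX j (by simp [hj]))

lemma tendstoInMeasure_const_sub {X : ι → Ω → E} {X' : Ω → E} (Y : Ω → E)
    (hX : TendstoInMeasure μ X l X') :
    TendstoInMeasure μ (fun n ω => Y ω - X n ω) l (fun ω => Y ω - X' ω) := by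
  simpa only [TendstoInMeasure, edist_sub_left] using hX

end TendstoInMeasure

/-! ### Riemann sums -/

section RiemannSum

variable {E : Type*} [NormedAddCommGroup E] {μ : Measure ℝ} [IsFiniteMeasure μ]

lemma norm_sum_smul_sub_setIntegral_le [NormedSpace ℝ E] [CompleteSpace E] {t : ℕ → ℝ}
    (ht : Monotone t) {n : ℕ} {g : ℝ → E} {ε : ℝ}
    (hg : IntegrableOn g (Set.Ioc (t 0) (t n)) μ)
    (hosc : ∀ k < n, ∀ θ ∈ Set.Ioc (t k) (t (k + 1)), ‖g (t k) - g θ‖ ≤ ε) :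
    ‖∑ k ∈ Finset.range n, μ.real (Set.Ioc (t k) (t (k + 1))) • g (t k) -
      ∫ θ in Set.Ioc (t 0) (t n), g θ ∂μ‖ ≤ ε * μ.real (Set.Ioc (t 0) (t n)) := by
  induction n with
  | zero => simp
  | succ n ih =>
    have hunion := Set.Ioc_union_Ioc_eq_Ioc (ht n.zero_le) (ht n.le_succ)
    have hdisj : Disjoint (Set.Ioc (t 0) (t n)) (Set.Ioc (t n) (t (n + 1))) :=
      Set.Ioc_disjoint_Ioc_of_le le_rfl
    rw [← hunion] at hg
    have hlast : ‖μ.real (Set.Ioc (t n) (t (n + 1))) • g (t n) -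
        ∫ θ in Set.Ioc (t n) (t (n + 1)), g θ ∂μ‖ ≤ ε * μ.real (Set.Ioc (t n) (t (n + 1))) := by
      rw [← setIntegral_const, ← integral_sub (integrable_const _) hg.right_of_union]
      exact norm_setIntegral_le_of_norm_le_const (measure_lt_top _ _) (hosc n n.lt_succ_self)
    rw [← hunion, setIntegral_union hdisj measurableSet_Ioc hg.left_of_union hg.right_of_union,
      measureReal_union hdisj measurableSet_Ioc, Finset.sum_range_succ, add_sub_add_comm, mul_add]
    exact norm_add_le_of_le (ih hg.left_of_union fun k hk => hosc k (hk.trans n.lt_succ_self)) hlast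

/-- The `k`-th point `a + (b - a) k / m` of the partition of `[a, b]` into `m` equal parts, used to
write `stieltjesSum` as a sum over consecutive terms of a monotone sequence. -/
noncomputable def gridPoint (a b : ℝ) (m k : ℕ) : ℝ := a + (b - a) * k / m

lemma gridPoint_zero (a b : ℝ) (m : ℕ) : gridPoint a b m 0 = a := by
  simp [gridPoint]

lemma gridPoint_self (a b : ℝ) {m : ℕ} (hm : m ≠ 0) : gridPoint a b m m = b := by
  simp only [gridPoint]
  field_simp
  ring

lemma gridPoint_succ (a b : ℝ) (m k : ℕ) :
    gridPoint a b m (k + 1) = gridPoint a b m k + (b - a) / m := by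
  simp only [gridPoint]
  push_cast
  ring

lemma monotone_gridPoint {a b : ℝ} (hab : a ≤ b) (m : ℕ) : Monotone (gridPoint a b m) :=
  monotone_nat_of_le_succ fun k => by
    rw [gridPoint_succ, le_add_iff_nonneg_right]
    exact div_nonneg (sub_nonneg.2 hab) m.cast_nonneg

lemma eventually_forall_norm_sub_gridPoint_le {a b : ℝ} (hab : a ≤ b) {g : ℝ → E}
    (hg : ContinuousOn g (Set.Icc a b)) {ε : ℝ} (hε : 0 < ε) :
    ∀ᶠ m : ℕ in atTop, ∀ k < m,
      ∀ θ ∈ Set.Ioc (gridPoint a b m k) (gridPoint a b m (k + 1)),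
        ‖g (gridPoint a b m k) - g θ‖ ≤ ε := by
  obtain ⟨δ, hδ, hgδ⟩ := Metric.uniformContinuousOn_iff.1
    (isCompact_Icc.uniformContinuousOn_of_continuous hg) ε hε
  filter_upwards [(tendsto_const_div_atTop_nhds_zero_nat (b - a)).eventually_lt_const hδ,
    eventually_ne_atTop 0] with m hmesh hm k hk θ hθ
  have hmono := monotone_gridPoint hab m
  have hak : a ≤ gridPoint a b m k := (gridPoint_zero a b m).ge.trans (hmono k.zero_le)
  have hkb : gridPoint a b m (k + 1) ≤ b := (hmono hk).trans_eq (gridPoint_self a b hm)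
  rw [← dist_eq_norm]
  refine (hgδ _ ⟨hak, (hmono k.le_succ).trans hkb⟩ θ ⟨hak.trans hθ.1.le, hθ.2.trans hkb⟩ ?_).le
  rw [Real.dist_eq, abs_sub_comm, abs_of_pos (sub_pos.2 hθ.1)]
  linarith [hθ.2, gridPoint_succ a b m k]

lemma tendsto_riemannSum [NormedSpace ℝ E] [CompleteSpace E] {a b : ℝ} (hab : a ≤ b) {g : ℝ → E}
    (hg : ContinuousOn g (Set.Icc a b)) :
    Tendsto (fun m : ℕ => ∑ k ∈ Finset.range m,
        μ.real (Set.Ioc (gridPoint a b m k) (gridPoint a b m (k + 1))) • g (gridPoint a b m k))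
      atTop (𝓝 (∫ θ in Set.Ioc a b, g θ ∂μ)) := by
  have hint : IntegrableOn g (Set.Ioc a b) μ :=
    (hg.integrableOn_compact isCompact_Icc).mono_set Set.Ioc_subset_Icc_self
  rw [Metric.tendsto_nhds]
  intro ε hε
  filter_upwards [eventually_forall_norm_sub_gridPoint_le hab hg
    (ε := ε / (μ.real (Set.Ioc a b) + 1)) (by positivity), eventually_ne_atTop 0] with m hosc hm
  have hbound := norm_sum_smul_sub_setIntegral_le (μ := μ) (monotone_gridPoint hab m)
    (n := m) (g := g) (by rwa [gridPoint_zero, gridPoint_self a b hm]) hosc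
  rw [gridPoint_zero, gridPoint_self a b hm, ← dist_eq_norm] at hbound
  refine hbound.trans_lt ?_
  rw [div_mul_eq_mul_div, div_lt_iff₀ (by positivity)]
  nlinarith [measureReal_nonneg (μ := μ) (s := Set.Ioc a b)]

lemma setLIntegral_enorm_rpow_eq_ofReal {α : ℝ} (hα : 0 ≤ α) {a b : ℝ} {g : ℝ → E}
    (hg : ContinuousOn g (Set.Icc a b)) :
    ∫⁻ θ in Set.Ioc a b, ‖g θ‖ₑ ^ α ∂μ = ENNReal.ofReal (∫ θ in Set.Ioc a b, ‖g θ‖ ^ α ∂μ) := by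
  have hcont : ContinuousOn (fun θ => ‖g θ‖ ^ α) (Set.Icc a b) :=
    hg.norm.rpow_const fun _ _ => Or.inr hα
  rw [ofReal_integral_eq_lintegral_ofReal
    ((hcont.integrableOn_compact isCompact_Icc).mono_set Set.Ioc_subset_Icc_self)
    (Eventually.of_forall fun θ => by positivity)]
  simp only [← ofReal_norm, ENNReal.ofReal_rpow_of_nonneg (norm_nonneg _) hα]

lemma tendsto_sum_enorm_rpow_mul_measure {α : ℝ} (hα : 0 ≤ α) {a b : ℝ} (hab : a ≤ b) {g : ℝ → E}
    (hg : ContinuousOn g (Set.Icc a b)) :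
    Tendsto (fun m : ℕ => ∑ k ∈ Finset.range m, ‖g (gridPoint a b m k)‖ₑ ^ α *
        μ (Set.Ioc (gridPoint a b m k) (gridPoint a b m (k + 1))))
      atTop (𝓝 (∫⁻ θ in Set.Ioc a b, ‖g θ‖ₑ ^ α ∂μ)) := by
  rw [setLIntegral_enorm_rpow_eq_ofReal hα hg]
  have hlim := tendsto_riemannSum (μ := μ) hab
    (hg.norm.rpow_const fun _ _ => Or.inr hα : ContinuousOn (fun θ => ‖g θ‖ ^ α) _)
  refine (ENNReal.tendsto_ofReal hlim).congr fun m => ?_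
  rw [ENNReal.ofReal_sum_of_nonneg fun k _ => by positivity]
  refine Finset.sum_congr rfl fun k _ => ?_
  rw [smul_eq_mul, mul_comm, ENNReal.ofReal_mul (by positivity), ofReal_measureReal, ← ofReal_norm,
    ENNReal.ofReal_rpow_of_nonneg (norm_nonneg _) hα]

end RiemannSum

/-! ### The spectral measure and the stochastic integral -/

lemma neg_pi_le_pi : -Real.pi ≤ Real.pi := neg_le_self Real.pi_pos.le

lemma spectralMeasure_absolutelyContinuous (f : ℝ → ℝ) :
    spectralMeasure f ≪ volume.restrict (Set.Ioc (-Real.pi) Real.pi) :=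
  withDensity_absolutelyContinuous _ _

lemma spectralMeasure_restrict (f : ℝ → ℝ) :
    (spectralMeasure f).restrict (Set.Ioc (-Real.pi) Real.pi) = spectralMeasure f := by
  rw [spectralMeasure, restrict_withDensity measurableSet_Ioc, Measure.restrict_restrict
    measurableSet_Ioc, Set.inter_self]

lemma isFiniteMeasure_spectralMeasure {f : ℝ → ℝ}
    (hf : IntegrableOn f (Set.Ioc (-Real.pi) Real.pi)) : IsFiniteMeasure (spectralMeasure f) :=
  isFiniteMeasure_withDensity hf.lintegral_lt_top.ne

lemma stieltjesSum_eq_sum_gridPoint {Ω : Type*} (Z : ℝ → Ω → ℂ) (g : ℝ → ℂ) (m : ℕ)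
    (ω : Ω) :
    stieltjesSum Z g m ω = ∑ k ∈ Finset.range m, g (gridPoint (-Real.pi) Real.pi m k) *
      (Z (gridPoint (-Real.pi) Real.pi m (k + 1)) ω - Z (gridPoint (-Real.pi) Real.pi m k) ω) := by
  simp only [stieltjesSum, gridPoint, sub_neg_eq_add, ← two_mul, Nat.cast_succ]

lemma trigSum_eq_linearCombination (b : ℤ →₀ ℂ) (θ : ℝ) :
    trigSum b θ = Finsupp.linearCombination ℂ (fun j : ℤ => Complex.exp (j * θ * Complex.I)) b :=
  rfl

lemma continuous_trigSum (b : ℤ →₀ ℂ) : Continuous (trigSum b) := by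
  unfold trigSum Finsupp.sum
  fun_prop

lemma trigSum_sub (b b' : ℤ →₀ ℂ) (θ : ℝ) :
    trigSum (b - b') θ = trigSum b θ - trigSum b' θ := by
  simp only [trigSum_eq_linearCombination, map_sub]

lemma stieltjesSum_trigSum {Ω : Type*} (Z : ℝ → Ω → ℂ) (b : ℤ →₀ ℂ) (m : ℕ) (ω : Ω) :
    stieltjesSum Z (trigSum b) m ω = ∑ j ∈ b.support,
      b j • stieltjesSum Z (fun θ => Complex.exp (j * θ * Complex.I)) m ω := by
  simp only [stieltjesSum, trigSum, Finsupp.sum, Finset.smul_sum, Finset.sum_mul]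
  rw [Finset.sum_comm]
  simp only [smul_eq_mul, mul_assoc]

section Harmonizable

variable {Ω : Type*} [MeasurableSpace Ω] {α : ℝ} {Pr : Measure Ω}

lemma hasCovariationNormPow_sum_increments {T : Type*} [LinearOrder T] [MeasurableSpace T]
    (hα : 0 ≤ α) {Z : T → Ω → ℂ} (hindep : HasIndepIncrements Z Pr) {μ : Measure T}
    (hincr : ∀ s t, s ≤ t →
      HasCovariationNormPow α Pr (fun ω => Z t ω - Z s ω) (μ (Set.Ioc s t)))
    {t : ℕ → T} (ht : Monotone t) (g : T → ℂ) (n : ℕ) :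
    HasCovariationNormPow α Pr
      (fun ω => ∑ k ∈ Finset.range n, g (t k) * (Z (t (k + 1)) ω - Z (t k) ω))
      (∑ k ∈ Finset.range n, ‖g (t k)‖ₑ ^ α * μ (Set.Ioc (t k) (t (k + 1)))) :=
  .sum hα _ ((hindep.nat ht).comp (fun k x => g (t k) * x) fun k => by fun_prop)
    fun k => (hincr _ _ (ht k.le_succ)).const_mul hα _

lemma hasCovariationNormPow_of_tendsto_stieltjesSum [IsProbabilityMeasure Pr] (hα : 0 ≤ α)
    {Z : ℝ → Ω → ℂ} (hindep : HasIndepIncrements Z Pr) {μ : Measure ℝ} [IsFiniteMeasure μ]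
    (hincr : ∀ s t, s ≤ t →
      HasCovariationNormPow α Pr (fun ω => Z t ω - Z s ω) (μ (Set.Ioc s t)))
    {g : ℝ → ℂ} (hg : ContinuousOn g (Set.Icc (-Real.pi) Real.pi)) {Y : Ω → ℂ}
    (hY : TendstoInMeasure Pr (stieltjesSum Z g) atTop Y) :
    HasCovariationNormPow α Pr Y
      (∫⁻ θ in Set.Ioc (-Real.pi) Real.pi, ‖g θ‖ₑ ^ α ∂μ) := by
  have hlim := tendsto_sum_enorm_rpow_mul_measure (μ := μ) hα neg_pi_le_pi hg
  have hfin := (setLIntegral_enorm_rpow_eq_ofReal (μ := μ) hα hg).trans_ne ENNReal.ofReal_ne_top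
  refine .of_tendstoInMeasure hα hfin hlim (fun m => ?_) hY
  simp only [funext (stieltjesSum_eq_sum_gridPoint Z g m)]
  exact hasCovariationNormPow_sum_increments hα hindep hincr (monotone_gridPoint neg_pi_le_pi m) g m

lemma IsHarmonizableStable.hasCovariationNormPow_sum [IsProbabilityMeasure Pr] (hα : 0 ≤ α)
    {ξ : ℤ → Ω → ℂ} {f : ℝ → ℝ} (hf : IntegrableOn f (Set.Ioc (-Real.pi) Real.pi))
    (hξ : IsHarmonizableStable α Pr ξ f) (b : ℤ →₀ ℂ) :
    HasCovariationNormPow α Pr (fun ω => b.sum fun j z => z * ξ j ω)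
      (∫⁻ θ, ‖trigSum b θ‖ₑ ^ α ∂(spectralMeasure f)) := by
  have := isFiniteMeasure_spectralMeasure hf
  obtain ⟨Z, -, hindep, hincr, hlim⟩ := hξ
  rw [← spectralMeasure_restrict]
  refine hasCovariationNormPow_of_tendsto_stieltjesSum hα hindep hincr
    (continuous_trigSum b).continuousOn ?_
  have hsum := tendstoInMeasure_sum b.support fun j _ => tendstoInMeasure_const_smul (b j) (hlim j)
  simp only [← stieltjesSum_trigSum] at hsum
  exact hsum

end Harmonizable

/-! ### The error of a linear estimate -/

/-- The coefficients of `A_N` as a finitely supported function on `ℤ`, so that both `polyA` and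
`functionalA` are linear combinations of the kind used in `trigSum` and `IsLinearEstimate`. -/
noncomputable def coeffA (N : ℕ) (a : ℕ → ℂ) : ℤ →₀ ℂ :=
  ∑ j ∈ Finset.range (N + 1), Finsupp.single (j : ℤ) (a j)

lemma linearCombination_coeffA (N : ℕ) (a : ℕ → ℂ) (φ : ℤ → ℂ) :
    Finsupp.linearCombination ℂ φ (coeffA N a) = ∑ j ∈ Finset.range (N + 1), a j * φ j := by
  simp only [coeffA, map_sum, Finsupp.linearCombination_single, smul_eq_mul]

lemma trigSum_coeffA (N : ℕ) (a : ℕ → ℂ) : trigSum (coeffA N a) = polyA N a := by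
  ext θ
  rw [trigSum_eq_linearCombination, linearCombination_coeffA]
  simp only [polyA, Int.cast_natCast]

lemma enorm_exp_mul_I (j : ℤ) (θ : ℝ) : ‖Complex.exp (j * θ * Complex.I)‖ₑ = 1 := by
  rw [← ofReal_norm, ← Complex.ofReal_intCast, ← Complex.ofReal_mul, Complex.norm_exp_ofReal_mul_I,
    ENNReal.ofReal_one]

lemma enorm_trigSum_le (b : ℤ →₀ ℂ) (θ : ℝ) : ‖trigSum b θ‖ₑ ≤ ∑ j ∈ b.support, ‖b j‖ₑ :=
  (enorm_sum_le _ _).trans_eq <| Finset.sum_congr rfl fun j _ => by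
    rw [enorm_mul, enorm_exp_mul_I, mul_one]

lemma memLp_trigSum {μ : Measure ℝ} [IsFiniteMeasure μ] (b : ℤ →₀ ℂ) (p : ℝ≥0∞) :
    MemLp (trigSum b) p μ :=
  .of_enorm_bound (continuous_trigSum b).aestronglyMeasurable
    (C := ∑ j ∈ b.support, ‖b j‖ₑ) (by simp) (.of_forall (enorm_trigSum_le b))

lemma memLp_polyA {μ : Measure ℝ} [IsFiniteMeasure μ] (N : ℕ) (a : ℕ → ℂ) (p : ℝ≥0∞) :
    MemLp (polyA N a) p μ :=
  trigSum_coeffA N a ▸ memLp_trigSum _ p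

section LpNorm

variable {X E : Type*} [MeasurableSpace X] [NormedAddCommGroup E] {μ : Measure X}

lemma lintegral_enorm_rpow_eq_eLpNorm_rpow {α : ℝ} (hα : 0 < α) (g : X → E) :
    ∫⁻ x, ‖g x‖ₑ ^ α ∂μ = eLpNorm g (ENNReal.ofReal α) μ ^ α := by
  have hpow := eLpNorm_nnreal_pow_eq_lintegral (f := g) (μ := μ) (p := α.toNNReal)
    (Real.toNNReal_pos.2 hα).ne'
  rw [Real.coe_toNNReal _ hα.le] at hpow
  exact hpow.symm

lemma tendsto_eLpNorm_of_tendsto_sub {p : ℝ≥0∞} (hp : 1 ≤ p) {g : X → E} {G : ℕ → X → E}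
    (hg : MemLp g p μ) (hG : ∀ n, AEStronglyMeasurable (G n) μ)
    (h : Tendsto (fun n => eLpNorm (G n - g) p μ) atTop (𝓝 0)) :
    Tendsto (fun n => eLpNorm (G n) p μ) atTop (𝓝 (eLpNorm g p μ)) := by
  have hlower : Tendsto (fun n => eLpNorm g p μ - eLpNorm (G n - g) p μ) atTop
      (𝓝 (eLpNorm g p μ - 0)) :=
    ENNReal.Tendsto.sub tendsto_const_nhds h (Or.inl hg.eLpNorm_ne_top)
  have hupper : Tendsto (fun n => eLpNorm g p μ + eLpNorm (G n - g) p μ) atTop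
      (𝓝 (eLpNorm g p μ + 0)) := tendsto_const_nhds.add h
  rw [tsub_zero] at hlower
  rw [add_zero] at hupper
  refine tendsto_of_tendsto_of_tendsto_of_le_of_le hlower hupper (fun n => ?_) fun n => ?_
  · rw [tsub_le_iff_right]
    simpa only [sub_sub_cancel] using eLpNorm_sub_le (hG n) ((hG n).sub hg.1) hp
  · simpa only [add_sub_cancel] using eLpNorm_add_le hg.1 ((hG n).sub hg.1) hp

end LpNorm

lemma estError_eq_eLpNorm_rpow {α : ℝ} (hα : 0 < α) (N : ℕ) (a : ℕ → ℂ) (h : ℝ → ℂ) (f : ℝ → ℝ) :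
    estError α N a h f = eLpNorm (polyA N a - h) (ENNReal.ofReal α) (spectralMeasure f) ^ α :=
  lintegral_enorm_rpow_eq_eLpNorm_rpow hα _

lemma memLp_polyA_sub {α : ℝ} {N : ℕ} (a : ℕ → ℂ) {f : ℝ → ℝ}
    (hf : IntegrableOn f (Set.Ioc (-Real.pi) Real.pi)) {h : ℝ → ℂ} (hh : h ∈ observedSpace α N f) :
    MemLp (polyA N a - h) (ENNReal.ofReal α) (spectralMeasure f) := by
  have := isFiniteMeasure_spectralMeasure hf
  exact (memLp_polyA N a _).sub hh.1

lemma IsLinearEstimate.hasCovariationNormPow_sub {Ω : Type*} [MeasurableSpace Ω] {α : ℝ}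
    (hα : 1 ≤ α) {N : ℕ} (a : ℕ → ℂ) {Pr : Measure Ω} [IsProbabilityMeasure Pr] {ξ : ℤ → Ω → ℂ}
    {f : ℝ → ℝ} (hf : IntegrableOn f (Set.Ioc (-Real.pi) Real.pi))
    (hξ : IsHarmonizableStable α Pr ξ f) {h : ℝ → ℂ} (hh : h ∈ observedSpace α N f) {η : Ω → ℂ}
    (hη : IsLinearEstimate α N Pr ξ f h η) :
    HasCovariationNormPow α Pr (fun ω => functionalA N a ξ ω - η ω) (estError α N a h f) := by
  have hα₀ : 0 < α := one_pos.trans_le hα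
  obtain ⟨b, -, hb, hlim⟩ := hη
  have hmem := memLp_polyA_sub a hf hh
  rw [estError_eq_eLpNorm_rpow hα₀]
  refine .of_tendstoInMeasure hα₀.le (X := fun n ω => (coeffA N a - b n).sum fun j z => z * ξ j ω)
    (ENNReal.rpow_ne_top_of_nonneg hα₀.le hmem.eLpNorm_ne_top) ?_
    (fun n => hξ.hasCovariationNormPow_sum hα₀.le hf _) ?_
  · simp only [lintegral_enorm_rpow_eq_eLpNorm_rpow hα₀]
    refine ((ENNReal.continuous_rpow_const (y := α)).tendsto _).comp
      (tendsto_eLpNorm_of_tendsto_sub (by simpa) hmem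
        (fun n => (continuous_trigSum _).aestronglyMeasurable) (hb.congr fun n => ?_))
    congr 1 with θ
    rw [Pi.sub_apply, Pi.sub_apply, trigSum_sub, trigSum_coeffA, sub_sub_sub_cancel_left]
  · have hsplit : ∀ n ω, (coeffA N a - b n).sum (fun j z => z * ξ j ω) =
        functionalA N a ξ ω - (b n).sum fun j z => z * ξ j ω := fun n ω =>
      (map_sub (Finsupp.linearCombination ℂ fun j => ξ j ω) _ _).trans <| by
        rw [linearCombination_coeffA]; rfl
    simp only [hsplit]
    exact tendstoInMeasure_const_sub (functionalA N a ξ) hlim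

/-! ### Density of trigonometric polynomials -/

lemma exists_trigSum_eq_of_mem_span {F : C(AddCircle (2 * Real.pi), ℂ)}
    (hF : F ∈ Submodule.span ℂ (Set.range (@fourier (2 * Real.pi)))) :
    ∃ b : ℤ →₀ ℂ, ∀ θ : ℝ, F θ = trigSum b θ := by
  obtain ⟨b, rfl⟩ := Finsupp.mem_span_range_iff_exists_finsupp.1 hF
  refine ⟨b, fun θ => ?_⟩
  have hpi : (Real.pi : ℂ) ≠ 0 := by exact_mod_cast Real.pi_ne_zero
  simp only [Finsupp.sum, trigSum, ContinuousMap.coe_sum, Finset.sum_apply,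
    ContinuousMap.coe_smul, Pi.smul_apply, smul_eq_mul, fourier_coe_apply]
  refine Finset.sum_congr rfl fun j _ => ?_
  congr 2
  push_cast
  field_simp

lemma exists_mem_span_fourier_eLpNorm_sub_lt {T : ℝ} [Fact (0 < T)] {μ : Measure (AddCircle T)}
    [IsFiniteMeasure μ] {p : ℝ≥0∞} (hp₁ : 1 ≤ p) (hp : p ≠ ∞) {g : AddCircle T → ℂ}
    (hg : MemLp g p μ) {ε : ℝ≥0∞} (hε : 0 < ε) :
    ∃ F ∈ Submodule.span ℂ (Set.range (@fourier T)), eLpNorm (g - ⇑F) p μ < ε := by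
  have : Fact (1 ≤ p) := ⟨hp₁⟩
  have hdense : Dense (ContinuousMap.toLp p μ ℂ ''
      (Submodule.span ℂ (Set.range (@fourier T)) : Set C(AddCircle T, ℂ))) :=
    (ContinuousMap.toLp_denseRange ℂ μ ℂ hp).dense_image (ContinuousLinearMap.continuous _)
      (Submodule.dense_iff_topologicalClosure_eq_top.2 span_fourier_closure_eq_top)
  obtain ⟨_, ⟨F, hF, rfl⟩, hlt⟩ := EMetric.mem_closure_iff.1 (hdense hg.toLp) ε hε
  refine ⟨F, hF, lt_of_eq_of_lt ?_ hlt⟩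
  rw [Lp.edist_def]
  exact eLpNorm_congr_ae (hg.coeFn_toLp.sub (ContinuousMap.coeFn_toLp μ F)).symm

lemma exists_trigSum_eLpNorm_sub_lt {ν : Measure ℝ} [IsFiniteMeasure ν]
    (hν : ∀ᵐ θ ∂ν, θ ∈ Set.Ioc (-Real.pi) Real.pi) {p : ℝ≥0∞} (hp₁ : 1 ≤ p) (hp : p ≠ ∞)
    {g : ℝ → ℂ} (hg : MemLp g p ν) {ε : ℝ≥0∞} (hε : 0 < ε) :
    ∃ b : ℤ →₀ ℂ, eLpNorm (fun θ => g θ - trigSum b θ) p ν < ε := by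
  have : Fact (0 < 2 * Real.pi) := ⟨by positivity⟩
  let s : AddCircle (2 * Real.pi) → ℝ := fun x =>
    (AddCircle.measurableEquivIoc (2 * Real.pi) (-Real.pi) x : ℝ)
  have hs : Measurable s := measurable_subtype_coe.comp (MeasurableEquiv.measurable _)
  have hq : Measurable ((↑) : ℝ → AddCircle (2 * Real.pi)) := AddCircle.measurable_mk'
  have hIoc : Set.Ioc (-Real.pi) (-Real.pi + 2 * Real.pi) = Set.Ioc (-Real.pi) Real.pi := by
    congr 1; ring
  have hsection : ∀ᵐ θ : ℝ ∂ν, s (θ : AddCircle (2 * Real.pi)) = θ := by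
    filter_upwards [hν] with θ hθ
    rw [← hIoc] at hθ
    exact congrArg Subtype.val
      ((AddCircle.equivIoc (2 * Real.pi) (-Real.pi)).apply_symm_apply ⟨θ, hθ⟩)
  have hmap : MeasurePreserving s (ν.map ((↑) : ℝ → AddCircle (2 * Real.pi))) ν :=
    ⟨hs, by rw [Measure.map_map hs hq, Measure.map_congr (g := id) (f := s ∘ _) hsection,
      Measure.map_id]⟩
  have hgs := hg.comp_measurePreserving hmap
  obtain ⟨F, hF, hlt⟩ := exists_mem_span_fourier_eLpNorm_sub_lt hp₁ hp hgs hε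
  obtain ⟨b, hb⟩ := exists_trigSum_eq_of_mem_span hF
  refine ⟨b, lt_of_eq_of_lt ?_ hlt⟩
  rw [eLpNorm_map_measure (hgs.1.sub F.continuous.aestronglyMeasurable) hq.aemeasurable]
  refine eLpNorm_congr_ae ?_
  filter_upwards [hsection] with θ hθ
  simp only [Function.comp_apply, Pi.sub_apply, hθ, hb]

/-! ### Fourier coefficients -/

lemma integral_exp_int_mul (n : ℤ) :
    ∫ θ in Set.Ioc (-Real.pi) Real.pi, Complex.exp (n * θ * Complex.I) =
      if n = 0 then (2 * Real.pi : ℂ) else 0 := by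
  split_ifs with hn
  · simp [hn, Real.pi_pos.le]
    ring
  · have hfreq : (n * Complex.I : ℂ) ≠ 0 := by simp [hn]
    have hperiod : (n * Complex.I * (Real.pi : ℝ) : ℂ) =
        n * Complex.I * ((-Real.pi : ℝ) : ℂ) + n * (2 * Real.pi * Complex.I) := by
      push_cast; ring
    simp only [mul_right_comm (n : ℂ) _ Complex.I]
    rw [← intervalIntegral.integral_of_le neg_pi_le_pi, integral_exp_mul_complex hfreq, hperiod,
      Complex.exp_periodic.int_mul n, sub_self, zero_div]

lemma integral_exp_mul_trigSum (b : ℤ →₀ ℂ) (k : ℤ) :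
    ∫ θ in Set.Ioc (-Real.pi) Real.pi, Complex.exp (-(k * θ * Complex.I)) * trigSum b θ =
      2 * Real.pi * b k := by
  have hexpand : ∀ θ : ℝ, Complex.exp (-(k * θ * Complex.I)) * trigSum b θ =
      ∑ j ∈ b.support, b j * Complex.exp (((j - k : ℤ) : ℂ) * θ * Complex.I) := fun θ => by
    rw [trigSum, Finsupp.sum, Finset.mul_sum]
    refine Finset.sum_congr rfl fun j _ => ?_
    rw [mul_left_comm, ← Complex.exp_add]
    push_cast
    ring_nf
  simp only [hexpand]
  rw [integral_finsetSum _ fun j _ => Continuous.integrableOn_Ioc (by fun_prop)]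
  simp only [integral_const_mul, integral_exp_int_mul, sub_eq_zero]
  simp [mul_comm]

lemma integral_trigSum_mul_polyC {N : ℕ} (c : ℕ → ℂ) {b : ℤ →₀ ℂ} (hb : IsObserved N b) :
    ∫ θ in Set.Ioc (-Real.pi) Real.pi, trigSum b θ * polyC N c θ = 0 := by
  have hexpand : ∀ θ : ℝ, trigSum b θ * polyC N c θ = ∑ k ∈ Finset.range (N + 1),
      c k * (Complex.exp (-(((k : ℤ) : ℂ) * θ * Complex.I)) * trigSum b θ) := fun θ => by
    rw [polyC, Finset.mul_sum]
    exact Finset.sum_congr rfl fun k _ => by push_cast; ring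
  have hcont := continuous_trigSum b
  simp only [hexpand]
  rw [integral_finsetSum _ fun k _ => Continuous.integrableOn_Ioc (by fun_prop)]
  refine Finset.sum_eq_zero fun k hk => ?_
  have hk₀ : b k = 0 := by
    by_contra hne
    exact hb k (by simpa using hne) ⟨by simp, by simpa using Finset.mem_range_succ_iff.1 hk⟩
  rw [integral_const_mul, integral_exp_mul_trigSum, hk₀, mul_zero, mul_zero]

/-! ### Functions with vanishing coefficients at the unobserved times -/

lemma enorm_coeff_le_lintegral {h : ℝ → ℂ} (hh : IntegrableOn h (Set.Ioc (-Real.pi) Real.pi))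
    {k : ℤ} (hk : ∫ θ in Set.Ioc (-Real.pi) Real.pi, Complex.exp (-(k * θ * Complex.I)) * h θ = 0)
    (b : ℤ →₀ ℂ) : ‖b k‖ₑ ≤ ∫⁻ θ in Set.Ioc (-Real.pi) Real.pi, ‖h θ - trigSum b θ‖ₑ := by
  have hexp : ∀ θ : ℝ, ‖Complex.exp (-(k * θ * Complex.I))‖ₑ = 1 := fun θ => by
    simpa only [Int.cast_neg, neg_mul] using enorm_exp_mul_I (-k) θ
  have hcont : Continuous fun θ : ℝ => Complex.exp (-(k * θ * Complex.I)) := by fun_prop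
  have hint : IntegrableOn (fun θ : ℝ => Complex.exp (-(k * θ * Complex.I)) * h θ)
      (Set.Ioc (-Real.pi) Real.pi) :=
    hh.bdd_mul (c := 1) hcont.aestronglyMeasurable <| .of_forall fun θ => by
      rw [← toReal_enorm, hexp, ENNReal.toReal_one]
  have hint_trig : IntegrableOn (fun θ : ℝ => Complex.exp (-(k * θ * Complex.I)) * trigSum b θ)
      (Set.Ioc (-Real.pi) Real.pi) := (hcont.mul (continuous_trigSum b)).integrableOn_Ioc
  have hcoef : ∫ θ in Set.Ioc (-Real.pi) Real.pi,
      Complex.exp (-(k * θ * Complex.I)) * (h θ - trigSum b θ) = -(2 * Real.pi * b k) := by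
    simp only [mul_sub]
    rw [integral_sub hint hint_trig, hk, zero_sub, integral_exp_mul_trigSum]
  have htwoPi : (1 : ℝ≥0∞) ≤ ‖(2 * Real.pi : ℂ)‖ₑ := by
    rw [← ofReal_norm, ENNReal.one_le_ofReal, norm_mul, Complex.norm_real, Complex.norm_ofNat,
      Real.norm_of_nonneg Real.pi_pos.le]
    linarith [Real.pi_gt_three]
  calc ‖b k‖ₑ ≤ ‖(2 * Real.pi : ℂ)‖ₑ * ‖b k‖ₑ := le_mul_of_one_le_left' htwoPi
    _ = ‖∫ θ in Set.Ioc (-Real.pi) Real.pi,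
        Complex.exp (-(k * θ * Complex.I)) * (h θ - trigSum b θ)‖ₑ := by
      rw [hcoef, enorm_neg, enorm_mul _ (b k)]
    _ ≤ _ := (enorm_integral_le_lintegral_enorm _).trans_eq <| by
      simp only [enorm_mul, hexp, one_mul]

lemma isObserved_filter (N : ℕ) (b : ℤ →₀ ℂ) :
    IsObserved N (b.filter (· ∉ Finset.Icc (0 : ℤ) N)) := fun j hj => by
  rw [Finsupp.support_filter, Finset.mem_filter, Finset.mem_Icc] at hj
  exact hj.2

lemma eLpNorm_trigSum_filter_mem_le {ν : Measure ℝ} (S : Finset ℤ) (b : ℤ →₀ ℂ) (p : ℝ≥0∞) :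
    eLpNorm (trigSum (b.filter (· ∈ S))) p ν ≤
      (∑ j ∈ S, ‖b j‖ₑ) * ν Set.univ ^ p.toReal⁻¹ := by
  have hsub : (b.filter (· ∈ S)).support ⊆ S := fun j hj => by
    rw [Finsupp.support_filter, Finset.mem_filter] at hj
    exact hj.2
  have hsum : ∑ j ∈ (b.filter (· ∈ S)).support, ‖b.filter (· ∈ S) j‖ₑ ≤ ∑ j ∈ S, ‖b j‖ₑ :=
    (Finset.sum_le_sum_of_subset hsub).trans_eq <| Finset.sum_congr rfl fun j hj => by
      rw [Finsupp.filter_apply_pos _ _ hj]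
  refine (eLpNorm_le_of_ae_enorm_bound <| .of_forall fun θ =>
    (enorm_trigSum_le _ θ).trans hsum).trans_eq ?_
  rw [smul_eq_mul, mul_comm]

lemma rpow_one_sub_inv_mul_rpow_inv {p : ℝ≥0∞} (hp : 1 ≤ p) (x : ℝ≥0∞) :
    x ^ (1 - p.toReal⁻¹) * x ^ p.toReal⁻¹ = x := by
  have hinv : p.toReal⁻¹ ≤ 1 := by
    rw [← ENNReal.toReal_inv]
    exact ENNReal.toReal_le_of_le_ofReal one_pos.le (by simpa using hp)
  rw [← ENNReal.rpow_add_of_nonneg _ _ (sub_nonneg.2 hinv) (by positivity), sub_add_cancel,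
    ENNReal.rpow_one]

-- Deleting the coefficients of `b` at `0, …, N` costs little: they are the coefficients of
-- `trigSum b - h`, hence small when `trigSum b` is close to `h`.
lemma eLpNorm_sub_trigSum_filter_le {ν : Measure ℝ} [IsFiniteMeasure ν]
    (hν : volume.restrict (Set.Ioc (-Real.pi) Real.pi) ≤ ν) {p : ℝ≥0∞} (hp : 1 ≤ p) {N : ℕ}
    {h : ℝ → ℂ} (hh : MemLp h p ν)
    (hcoef : ∀ k ∈ Finset.Icc (0 : ℤ) N,
      ∫ θ in Set.Ioc (-Real.pi) Real.pi, Complex.exp (-(k * θ * Complex.I)) * h θ = 0)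
    (b : ℤ →₀ ℂ) :
    eLpNorm (fun θ => h θ - trigSum (b.filter (· ∉ Finset.Icc (0 : ℤ) N)) θ) p ν ≤
      (1 + (N + 1) * ν Set.univ) * eLpNorm (fun θ => h θ - trigSum b θ) p ν := by
  set S := Finset.Icc (0 : ℤ) N
  set e := eLpNorm (fun θ => h θ - trigSum b θ) p ν
  have hdiff : AEStronglyMeasurable (fun θ => h θ - trigSum b θ) ν :=
    hh.1.sub (continuous_trigSum b).aestronglyMeasurable
  have hint : IntegrableOn h (Set.Ioc (-Real.pi) Real.pi) := (hh.integrable hp).mono_measure hν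
  have hcoeff : ∀ k ∈ S, ‖b k‖ₑ ≤ e * ν Set.univ ^ (1 - p.toReal⁻¹) := fun k hk => by
    calc ‖b k‖ₑ ≤ ∫⁻ θ, ‖h θ - trigSum b θ‖ₑ ∂ν :=
        (enorm_coeff_le_lintegral hint (hcoef k hk) b).trans (lintegral_mono' hν le_rfl)
      _ ≤ _ := by
        rw [← eLpNorm_one_eq_lintegral_enorm]
        simpa using eLpNorm_le_eLpNorm_mul_rpow_measure_univ hp hdiff
  have hsplit : (fun θ => h θ - trigSum (b.filter (· ∉ S)) θ) =
      (fun θ => h θ - trigSum b θ) + trigSum (b.filter (· ∈ S)) := by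
    ext θ
    rw [Pi.add_apply, eq_sub_of_add_eq (Finsupp.filter_add_filter_not b (· ∈ S)), trigSum_sub]
    ring
  calc _ ≤ e + eLpNorm (trigSum (b.filter (· ∈ S))) p ν := by
        rw [hsplit]
        exact eLpNorm_add_le hdiff (continuous_trigSum _).aestronglyMeasurable hp
    _ ≤ e + (∑ _k ∈ S, e * ν Set.univ ^ (1 - p.toReal⁻¹)) * ν Set.univ ^ p.toReal⁻¹ := by
        gcongr
        exact (eLpNorm_trigSum_filter_mem_le S b p).trans (by gcongr with k hk; exact hcoeff k hk)
    _ = e + (N + 1) * (e * (ν Set.univ ^ (1 - p.toReal⁻¹) * ν Set.univ ^ p.toReal⁻¹)) := by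
        simp [S]
        ring
    _ = (1 + (N + 1) * ν Set.univ) * e := by
        rw [rpow_one_sub_inv_mul_rpow_inv hp]
        ring

lemma mem_observedSpace_of_memLp {α : ℝ} (hα : 1 ≤ α) {N : ℕ} {f : ℝ → ℝ}
    (hf : IntegrableOn f (Set.Ioc (-Real.pi) Real.pi)) {h : ℝ → ℂ}
    (hh : MemLp h (ENNReal.ofReal α)
      (volume.restrict (Set.Ioc (-Real.pi) Real.pi) + spectralMeasure f))
    (hcoef : ∀ k : ℕ, k ≤ N →
      ∫ θ in Set.Ioc (-Real.pi) Real.pi, Complex.exp (-(k * θ * Complex.I)) * h θ = 0) :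
    h ∈ observedSpace α N f := by
  have := isFiniteMeasure_spectralMeasure hf
  set ν := volume.restrict (Set.Ioc (-Real.pi) Real.pi) + spectralMeasure f
  have hspec : spectralMeasure f ≤ ν := Measure.le_add_left le_rfl
  have hp : 1 ≤ ENNReal.ofReal α := ENNReal.one_le_ofReal.2 hα
  have hν : ∀ᵐ θ ∂ν, θ ∈ Set.Ioc (-Real.pi) Real.pi :=
    (Measure.AbsolutelyContinuous.add_left .rfl (spectralMeasure_absolutelyContinuous f)).ae_le
      (ae_restrict_mem measurableSet_Ioc)
  have hcoef' : ∀ k ∈ Finset.Icc (0 : ℤ) N,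
      ∫ θ in Set.Ioc (-Real.pi) Real.pi, Complex.exp (-(k * θ * Complex.I)) * h θ = 0 := by
    intro k hk
    rw [Finset.mem_Icc] at hk
    lift k to ℕ using hk.1
    simpa using hcoef k (by exact_mod_cast hk.2)
  refine ⟨hh.mono_measure hspec, fun ε hε => ?_⟩
  obtain ⟨δ, hδ, hδε⟩ := ENNReal.exists_nnreal_pos_mul_lt
    (a := 1 + (N + 1) * ν Set.univ) (by finiteness) hε.ne'
  obtain ⟨b, hb⟩ := exists_trigSum_eLpNorm_sub_lt hν hp ENNReal.ofReal_ne_top hh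
    (ENNReal.coe_pos.2 hδ)
  refine ⟨_, isObserved_filter N b, lt_of_le_of_lt ?_ hδε⟩
  calc _ ≤ eLpNorm (fun θ => h θ - trigSum (b.filter (· ∉ Finset.Icc (0 : ℤ) N)) θ) _ ν :=
        eLpNorm_mono_measure _ hspec
    _ ≤ (1 + (N + 1) * ν Set.univ) * eLpNorm (fun θ => h θ - trigSum b θ) _ ν :=
        eLpNorm_sub_trigSum_filter_le (Measure.le_add_right le_rfl) hp hh hcoef' b
    _ ≤ δ * (1 + (N + 1) * ν Set.univ) := by
        rw [mul_comm]
        gcongr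

/-! ### Optimality and the saddle point -/

lemma strictConvexOn_norm_rpow {E : Type*} [NormedAddCommGroup E] [NormedSpace ℝ E]
    [StrictConvexSpace ℝ E] {α : ℝ} (hα : 1 < α) :
    StrictConvexOn ℝ Set.univ fun x : E => ‖x‖ ^ α := by
  refine ⟨convex_univ, fun x _ y _ hxy s t hs ht hst => ?_⟩
  have hα₀ : 0 < α := one_pos.trans hα
  by_cases hnorm : ‖x‖ = ‖y‖
  · calc ‖s • x + t • y‖ ^ α < ‖y‖ ^ α :=
        Real.rpow_lt_rpow (norm_nonneg _)
          (norm_combo_lt_of_ne hnorm.le le_rfl hxy hs ht hst) hα₀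
      _ = s • ‖x‖ ^ α + t • ‖y‖ ^ α := by rw [hnorm, ← add_smul, hst, one_smul]
  · calc ‖s • x + t • y‖ ^ α ≤ (s • ‖x‖ + t • ‖y‖) ^ α := by
          gcongr
          simpa only [norm_smul_of_nonneg hs.le, norm_smul_of_nonneg ht.le, smul_eq_mul] using
            norm_add_le (s • x) (t • y)
      _ < s • ‖x‖ ^ α + t • ‖y‖ ^ α :=
        (strictConvexOn_rpow hα).2 (norm_nonneg x) (norm_nonneg y) hnorm hs ht hst

lemma ae_eq_const_or_enorm_rpow_mul_lt_lintegral {X E : Type*} [MeasurableSpace X]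
    {μ : Measure X} [IsFiniteMeasure μ] [NormedAddCommGroup E] [NormedSpace ℝ E] [CompleteSpace E]
    [StrictConvexSpace ℝ E] {α : ℝ} (hα : 1 < α) {w : X → E} (hw : MemLp w (ENNReal.ofReal α) μ)
    {v : E} (hv : ∫ x, w x ∂μ = μ.real Set.univ • v) :
    (∀ᵐ x ∂μ, w x = v) ∨ ‖v‖ₑ ^ α * μ Set.univ < ∫⁻ x, ‖w x‖ₑ ^ α ∂μ := by
  rcases eq_zero_or_neZero μ with rfl | _
  · exact .inl (by simp)
  have hα₀ : 0 < α := one_pos.trans hα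
  have hpow : Integrable (fun x => ‖w x‖ ^ α) μ := by
    simpa only [ENNReal.toReal_ofReal hα₀.le] using
      hw.integrable_norm_rpow (by simpa using hα₀) ENNReal.ofReal_ne_top
  have haverage : ⨍ x, w x ∂μ = v := by
    rw [average_eq, hv, inv_smul_smul₀ (measureReal_univ_ne_zero (μ := μ))]
  refine ((strictConvexOn_norm_rpow hα).ae_eq_const_or_map_average_lt
    (continuous_norm.rpow_const fun _ => .inr hα₀.le).continuousOn isClosed_univ (by simp)
    (hw.integrable (by simpa using hα.le)) hpow).imp (fun h => by rwa [haverage] at h) fun h => ?_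
  rw [haverage, average_eq, smul_eq_mul, lt_inv_mul_iff₀ measureReal_univ_pos] at h
  have hofReal : ∀ y : E, ‖y‖ₑ ^ α = ENNReal.ofReal (‖y‖ ^ α) := fun y => by
    rw [← ofReal_norm, ENNReal.ofReal_rpow_of_nonneg (norm_nonneg y) hα₀.le]
  simp only [hofReal]
  rw [← ofReal_integral_eq_lintegral_ofReal hpow (.of_forall fun x => by positivity),
    mul_comm, ← ofReal_measureReal, ← ENNReal.ofReal_mul measureReal_nonneg]
  exact (ENNReal.ofReal_lt_ofReal_iff_of_nonneg (by positivity)).2 h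

lemma integral_mul_eq_zero_of_mem_observedSpace {α : ℝ} {N : ℕ} {f : ℝ → ℝ}
    (hf : IntegrableOn f (Set.Ioc (-Real.pi) Real.pi)) {q : ℝ≥0∞}
    [ENNReal.HolderConjugate (ENNReal.ofReal α) q] {u : ℝ → ℂ} (hu : MemLp u q (spectralMeasure f))
    (horth : ∀ b, IsObserved N b → ∫ θ, trigSum b θ * u θ ∂(spectralMeasure f) = 0) {g : ℝ → ℂ}
    (hg : g ∈ observedSpace α N f) : ∫ θ, g θ * u θ ∂(spectralMeasure f) = 0 := by
  have := isFiniteMeasure_spectralMeasure hf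
  by_contra hne
  obtain ⟨δ, hδ, hδε⟩ := ENNReal.exists_nnreal_pos_mul_lt hu.eLpNorm_ne_top (enorm_ne_zero.2 hne)
  obtain ⟨b, hb, hbδ⟩ := hg.2 δ (ENNReal.coe_pos.2 hδ)
  have hgu : Integrable (fun θ => g θ * u θ) (spectralMeasure f) := hg.1.integrable_mul hu
  have hbu : Integrable (fun θ => trigSum b θ * u θ) (spectralMeasure f) :=
    (memLp_trigSum b (ENNReal.ofReal α)).integrable_mul hu
  refine hδε.not_ge ?_
  calc ‖∫ θ, g θ * u θ ∂(spectralMeasure f)‖ₑ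
      = ‖∫ θ, (g θ - trigSum b θ) * u θ ∂(spectralMeasure f)‖ₑ := by
        simp only [sub_mul]
        rw [integral_sub hgu hbu, horth b hb, sub_zero]
    _ ≤ eLpNorm ((fun θ => g θ - trigSum b θ) • u) 1 (spectralMeasure f) := by
        rw [eLpNorm_one_eq_lintegral_enorm]
        exact enorm_integral_le_lintegral_enorm _
    _ ≤ eLpNorm (fun θ => g θ - trigSum b θ) (ENNReal.ofReal α) (spectralMeasure f) *
          eLpNorm u q (spectralMeasure f) :=
        eLpNorm_smul_le_mul_eLpNorm hu.1 (hg.1.1.sub (continuous_trigSum b).aestronglyMeasurable)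
    _ ≤ δ * eLpNorm u q (spectralMeasure f) := by gcongr

section Optimality

variable {α : ℝ} {N : ℕ} {a : ℕ → ℂ}

lemma estError_congr {f : ℝ → ℝ} {g h : ℝ → ℂ} (hgh : g =ᵐ[spectralMeasure f] h) :
    estError α N a g f = estError α N a h f :=
  lintegral_congr_ae <| hgh.mono fun θ hθ => by simp only [hθ]

lemma integral_polyA_sub_mul_eq_of_orthogonal {f : ℝ → ℝ}
    (hf : IntegrableOn f (Set.Ioc (-Real.pi) Real.pi)) {q : ℝ≥0∞}
    [ENNReal.HolderConjugate (ENNReal.ofReal α) q] {u : ℝ → ℂ} (hu : MemLp u q (spectralMeasure f))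
    (horth : ∀ b, IsObserved N b → ∫ θ, trigSum b θ * u θ ∂(spectralMeasure f) = 0) {g : ℝ → ℂ}
    (hg : g ∈ observedSpace α N f) :
    ∫ θ, (polyA N a θ - g θ) * u θ ∂(spectralMeasure f) =
      ∫ θ, polyA N a θ * u θ ∂(spectralMeasure f) := by
  have := isFiniteMeasure_spectralMeasure hf
  have hAu : Integrable (fun θ => polyA N a θ * u θ) (spectralMeasure f) :=
    (memLp_polyA N a (ENNReal.ofReal α)).integrable_mul hu
  have hgu : Integrable (fun θ => g θ * u θ) (spectralMeasure f) := hg.1.integrable_mul hu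
  simp only [sub_mul]
  rw [integral_sub hAu hgu, integral_mul_eq_zero_of_mem_observedSpace hf hu horth hg, sub_zero]

-- The functions `(A_N - g) u` have the same modulus as `A_N - g` and all have the same mean, so
-- Jensen's inequality singles out the `g` for which `(A_N - g) u` is constant.
lemma ae_eq_or_estError_lt (hα : 1 < α) {f : ℝ → ℝ}
    (hf : IntegrableOn f (Set.Ioc (-Real.pi) Real.pi)) {u : ℝ → ℂ}
    (hu : AEStronglyMeasurable u (spectralMeasure f)) (hu₁ : ∀ᵐ θ ∂(spectralMeasure f), ‖u θ‖ = 1)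
    (horth : ∀ b, IsObserved N b → ∫ θ, trigSum b θ * u θ ∂(spectralMeasure f) = 0)
    {h₀ : ℝ → ℂ} (hh₀ : h₀ ∈ observedSpace α N f) {K : ℂ}
    (hK : ∀ᵐ θ ∂(spectralMeasure f), (polyA N a θ - h₀ θ) * u θ = K) {g : ℝ → ℂ}
    (hg : g ∈ observedSpace α N f) :
    g =ᵐ[spectralMeasure f] h₀ ∨ estError α N a h₀ f < estError α N a g f := by
  have := isFiniteMeasure_spectralMeasure hf
  have := ENNReal.HolderConjugate.conjExponent (ENNReal.one_le_ofReal.2 hα.le)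
  have hu_memLp (p : ℝ≥0∞) : MemLp u p (spectralMeasure f) :=
    .of_bound hu 1 (hu₁.mono fun θ h => h.le)
  have herr (g) : estError α N a g f =
      ∫⁻ θ, ‖(polyA N a θ - g θ) * u θ‖ₑ ^ α ∂(spectralMeasure f) :=
    lintegral_congr_ae <| hu₁.mono fun θ h => by
      simp only [enorm_mul, ← ofReal_norm (u θ), h, ENNReal.ofReal_one, mul_one]
  have hmean : ∫ θ, (polyA N a θ - g θ) * u θ ∂(spectralMeasure f) =
      (spectralMeasure f).real Set.univ • K := by
    have hmean_polyA {g} (hg : g ∈ observedSpace α N f) := integral_polyA_sub_mul_eq_of_orthogonal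
      (a := a) hf (hu_memLp (ENNReal.ofReal α).conjExponent) horth hg
    rw [hmean_polyA hg, ← hmean_polyA hh₀, integral_congr_ae hK, integral_const]
  have herr₀ : estError α N a h₀ f = ‖K‖ₑ ^ α * spectralMeasure f Set.univ := by
    rw [herr, ← lintegral_const]
    exact lintegral_congr_ae <| hK.mono fun θ h => by simp only [h]
  rw [herr₀, herr]
  refine (ae_eq_const_or_enorm_rpow_mul_lt_lintegral hα
    ((hu_memLp ∞).mul' (memLp_polyA_sub a hf hg)) hmean).imp_left fun hconst => ?_
  filter_upwards [hconst, hK, hu₁] with θ hgθ hh₀θ huθ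
  have hu₀ : u θ ≠ 0 := norm_ne_zero_iff.1 (huθ.trans_ne one_ne_zero)
  exact sub_right_injective (mul_right_cancel₀ hu₀ (hgθ.trans hh₀θ.symm))

lemma IsOptimalCharacteristic.isLeastFavorable {D : Set (ℝ → ℝ)} {f₀ : ℝ → ℝ} {h₀ : ℝ → ℂ}
    (hopt : IsOptimalCharacteristic α N a f₀ h₀) (hf₀ : f₀ ∈ D) (hh₀ : h₀ ∈ minimaxSpace α N D)
    (hsaddle : ∀ f ∈ D, estError α N a h₀ f ≤ estError α N a h₀ f₀) :
    IsLeastFavorable α N a D f₀ :=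
  ⟨hf₀, ⟨h₀, hopt⟩, fun f hf =>
    calc optimalError α N a f ≤ estError α N a h₀ f := iInf₂_le h₀ (Set.mem_iInter₂.1 hh₀ f hf)
      _ ≤ estError α N a h₀ f₀ := hsaddle f hf
      _ ≤ optimalError α N a f₀ := le_iInf₂ hopt.2⟩

lemma IsOptimalCharacteristic.isMinimaxCharacteristic {D : Set (ℝ → ℝ)} {f₀ : ℝ → ℝ} {h₀ : ℝ → ℂ}
    (hopt : IsOptimalCharacteristic α N a f₀ h₀) (hf₀ : f₀ ∈ D) (hh₀ : h₀ ∈ minimaxSpace α N D)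
    (hsaddle : ∀ f ∈ D, estError α N a h₀ f ≤ estError α N a h₀ f₀) :
    IsMinimaxCharacteristic α N a D h₀ :=
  ⟨hh₀, ⟨f₀, hf₀, hsaddle⟩, fun h hh =>
    calc ⨆ f ∈ D, estError α N a h₀ f ≤ estError α N a h₀ f₀ := iSup₂_le hsaddle
      _ ≤ estError α N a h f₀ := hopt.2 h (Set.mem_iInter₂.1 hh f₀ hf₀)
      _ ≤ ⨆ f ∈ D, estError α N a h f :=
        le_iSup₂ (f := fun f (_ : f ∈ D) => estError α N a h f) f₀ hf₀⟩

end Optimality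

/-! ### The least favorable density -/

/-- The phase `C_N / |C_N|` of `C_N`, with value `0` at the zeros of `C_N`. -/
noncomputable def phaseC (N : ℕ) (c : ℕ → ℂ) (θ : ℝ) : ℂ := polyC N c θ / ‖polyC N c θ‖

lemma continuous_polyC (N : ℕ) (c : ℕ → ℂ) : Continuous (polyC N c) := by
  unfold polyC
  fun_prop

lemma measurable_phaseC (N : ℕ) (c : ℕ → ℂ) : Measurable (phaseC N c) := by
  have := (continuous_polyC N c).measurable
  unfold phaseC
  fun_prop

lemma norm_mul_phaseC (N : ℕ) (c : ℕ → ℂ) (θ : ℝ) :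
    ‖polyC N c θ‖ * phaseC N c θ = polyC N c θ :=
  mul_div_cancel_of_imp' fun h => norm_eq_zero.1 (Complex.ofReal_eq_zero.1 h)

lemma norm_phaseC {N : ℕ} {c : ℕ → ℂ} {θ : ℝ} (h : polyC N c θ ≠ 0) : ‖phaseC N c θ‖ = 1 := by
  rw [phaseC, norm_div, Complex.norm_real, norm_norm, div_self (norm_ne_zero_iff.2 h)]

lemma signedPow_inv_mul {C : ℝ} (hC : 0 < C) {z : ℂ} (hz : z ≠ 0) (β : ℝ) :
    signedPow (((C * ‖z‖)⁻¹ : ℝ) * z) β = (C⁻¹ ^ β : ℝ) * conj (z / ‖z‖) := by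
  have hz₀ : ‖z‖ ≠ 0 := norm_ne_zero_iff.2 hz
  have hphase : ((C * ‖z‖)⁻¹ : ℝ) * z = (C⁻¹ : ℝ) * (z / ‖z‖) := by
    push_cast
    ring
  have hnorm : ‖(C⁻¹ : ℝ) * (z / ‖z‖)‖ = C⁻¹ := by
    rw [norm_mul, norm_div, Complex.norm_real, Complex.norm_real, norm_norm, div_self hz₀, mul_one,
      Real.norm_of_nonneg (inv_nonneg.2 hC.le)]
  rw [signedPow, hphase, hnorm, map_mul, Complex.conj_ofReal, ← mul_assoc, ← Complex.ofReal_mul,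
    ← Real.rpow_add_one (inv_ne_zero hC.ne'), sub_add_cancel]

lemma spectralMeasure_univ {P : ℝ} {f : ℝ → ℝ} (hf : f ∈ densityClass P) :
    spectralMeasure f Set.univ = ENNReal.ofReal P := by
  rw [spectralMeasure, withDensity_apply _ MeasurableSet.univ, Measure.restrict_univ,
    ← ofReal_integral_eq_lintegral_ofReal hf.1 hf.2.1, hf.2.2]

lemma integral_spectralMeasure {f : ℝ → ℝ}
    (hf : AEMeasurable f (volume.restrict (Set.Ioc (-Real.pi) Real.pi)))
    (hf₀ : ∀ᵐ θ ∂(volume.restrict (Set.Ioc (-Real.pi) Real.pi)), 0 ≤ f θ) (g : ℝ → ℂ) :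
    ∫ θ, g θ ∂(spectralMeasure f) = ∫ θ in Set.Ioc (-Real.pi) Real.pi, (f θ : ℂ) * g θ := by
  rw [spectralMeasure, integral_withDensity_eq_integral_toReal_smul₀
    hf.ennreal_ofReal (by simp)]
  refine integral_congr_ae (hf₀.mono fun θ hθ => ?_)
  simp only [ENNReal.toReal_ofReal hθ, Complex.real_smul]

lemma estError_eq_of_ae_norm_eq {α P K : ℝ} {N : ℕ} {a : ℕ → ℂ} {h : ℝ → ℂ}
    (hK : ∀ᵐ θ ∂(volume.restrict (Set.Ioc (-Real.pi) Real.pi)), ‖polyA N a θ - h θ‖ = K)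
    {f : ℝ → ℝ} (hf : f ∈ densityClass P) :
    estError α N a h f = ENNReal.ofReal K ^ α * ENNReal.ofReal P := by
  rw [← spectralMeasure_univ hf, ← lintegral_const, estError]
  refine lintegral_congr_ae ?_
  filter_upwards [(spectralMeasure_absolutelyContinuous f).ae_le hK] with θ hθ
  rw [← ofReal_norm, hθ]

lemma ae_pos_of_minimality {α : ℝ} (hα : 1 < α) {f : ℝ → ℝ}
    (hf : AEMeasurable f (volume.restrict (Set.Ioc (-Real.pi) Real.pi))) (hmin : Minimality α f) :
    ∀ᵐ θ ∂(volume.restrict (Set.Ioc (-Real.pi) Real.pi)), 0 < f θ := by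
  have hexponent : -1 / (α - 1) < 0 := div_neg_of_neg_of_pos (by norm_num) (sub_pos.2 hα)
  filter_upwards [ae_lt_top' (hf.ennreal_ofReal.pow_const _) hmin.ne] with θ hθ
  contrapose! hθ
  rw [ENNReal.ofReal_of_nonpos hθ, ENNReal.zero_rpow_of_neg hexponent]

section PhaseDensity

variable {α C P : ℝ} {N : ℕ} {a c : ℕ → ℂ} {f₀ : ℝ → ℝ}

lemma integral_trigSum_mul_phaseC
    (hform : ∀ᵐ θ ∂(volume.restrict (Set.Ioc (-Real.pi) Real.pi)), f₀ θ = C * ‖polyC N c θ‖)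
    (hclass : f₀ ∈ densityClass P) {b : ℤ →₀ ℂ} (hb : IsObserved N b) :
    ∫ θ, trigSum b θ * phaseC N c θ ∂(spectralMeasure f₀) = 0 := by
  calc ∫ θ, trigSum b θ * phaseC N c θ ∂(spectralMeasure f₀)
      = ∫ θ in Set.Ioc (-Real.pi) Real.pi, (C : ℂ) * (trigSum b θ * polyC N c θ) := by
        rw [integral_spectralMeasure hclass.1.aemeasurable hclass.2.1]
        refine integral_congr_ae (hform.mono fun θ hθ => ?_)
        simp only [hθ, Complex.ofReal_mul]
        conv_rhs => rw [← norm_mul_phaseC]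
        ring
    _ = 0 := by rw [integral_const_mul, integral_trigSum_mul_polyC c hb, mul_zero]

lemma pos_of_ae_pos_of_ae_eq_mul_norm
    (hform : ∀ᵐ θ ∂(volume.restrict (Set.Ioc (-Real.pi) Real.pi)), f₀ θ = C * ‖polyC N c θ‖)
    (hpos : ∀ᵐ θ ∂(volume.restrict (Set.Ioc (-Real.pi) Real.pi)), 0 < f₀ θ) : 0 < C := by
  have : NeBot (ae (volume.restrict (Set.Ioc (-Real.pi) Real.pi))) := by
    rw [ae_restrict_neBot, Real.volume_Ioc, Ne, ENNReal.ofReal_eq_zero]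
    linarith [Real.pi_pos]
  obtain ⟨θ, hθ, hθform⟩ := (hpos.and hform).exists
  exact pos_of_mul_pos_left (hθform ▸ hθ) (norm_nonneg _)

lemma ae_norm_phaseC_eq_one
    (hform : ∀ᵐ θ ∂(volume.restrict (Set.Ioc (-Real.pi) Real.pi)), f₀ θ = C * ‖polyC N c θ‖)
    (hpos : ∀ᵐ θ ∂(volume.restrict (Set.Ioc (-Real.pi) Real.pi)), 0 < f₀ θ) :
    ∀ᵐ θ ∂(volume.restrict (Set.Ioc (-Real.pi) Real.pi)), ‖phaseC N c θ‖ = 1 := by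
  filter_upwards [hform, hpos] with θ hθform hθ
  refine norm_phaseC fun hzero => hθ.ne' ?_
  rw [hθform, hzero, norm_zero, mul_zero]

lemma ae_polyA_sub_spectralCharacteristic
    (hform : ∀ᵐ θ ∂(volume.restrict (Set.Ioc (-Real.pi) Real.pi)), f₀ θ = C * ‖polyC N c θ‖)
    (hpos : ∀ᵐ θ ∂(volume.restrict (Set.Ioc (-Real.pi) Real.pi)), 0 < f₀ θ) :
    ∀ᵐ θ ∂(volume.restrict (Set.Ioc (-Real.pi) Real.pi)),
      polyA N a θ - spectralCharacteristic α N a c f₀ θ =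
        (C⁻¹ ^ (1 / (α - 1)) : ℝ) * conj (phaseC N c θ) := by
  filter_upwards [hform, hpos] with θ hθform hθ
  have hzero : polyC N c θ ≠ 0 := fun hzero => hθ.ne' (by rw [hθform, hzero, norm_zero, mul_zero])
  rw [spectralCharacteristic, sub_sub_cancel, hθform,
    signedPow_inv_mul (pos_of_ae_pos_of_ae_eq_mul_norm hform hpos) hzero, phaseC]

lemma ae_norm_polyA_sub_spectralCharacteristic
    (hform : ∀ᵐ θ ∂(volume.restrict (Set.Ioc (-Real.pi) Real.pi)), f₀ θ = C * ‖polyC N c θ‖)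
    (hpos : ∀ᵐ θ ∂(volume.restrict (Set.Ioc (-Real.pi) Real.pi)), 0 < f₀ θ) :
    ∀ᵐ θ ∂(volume.restrict (Set.Ioc (-Real.pi) Real.pi)),
      ‖polyA N a θ - spectralCharacteristic α N a c f₀ θ‖ = C⁻¹ ^ (1 / (α - 1)) := by
  have hC := pos_of_ae_pos_of_ae_eq_mul_norm hform hpos
  filter_upwards [ae_polyA_sub_spectralCharacteristic hform hpos,
    ae_norm_phaseC_eq_one hform hpos] with θ hdiff hphase
  rw [hdiff, norm_mul, RCLike.norm_conj, hphase, mul_one, Complex.norm_real,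
    Real.norm_of_nonneg (by positivity)]

lemma memLp_spectralCharacteristic
    (hform : ∀ᵐ θ ∂(volume.restrict (Set.Ioc (-Real.pi) Real.pi)), f₀ θ = C * ‖polyC N c θ‖)
    (hpos : ∀ᵐ θ ∂(volume.restrict (Set.Ioc (-Real.pi) Real.pi)), 0 < f₀ θ)
    {ν : Measure ℝ} [IsFiniteMeasure ν] (hν : ν ≪ volume.restrict (Set.Ioc (-Real.pi) Real.pi))
    (p : ℝ≥0∞) : MemLp (spectralCharacteristic α N a c f₀) p ν := by
  have hphase : AEStronglyMeasurable
      (fun θ => ((C⁻¹ ^ (1 / (α - 1)) : ℝ) : ℂ) * conj (phaseC N c θ)) ν :=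
    ((Complex.continuous_conj.measurable.comp (measurable_phaseC N c)).const_mul
      _).aestronglyMeasurable
  have hbound : ∀ᵐ θ ∂ν,
      ‖(polyA N a - spectralCharacteristic α N a c f₀) θ‖ ≤ C⁻¹ ^ (1 / (α - 1)) :=
    hν.ae_le <| (ae_norm_polyA_sub_spectralCharacteristic hform hpos).mono fun _ => le_of_eq
  have hdiff : MemLp (polyA N a - spectralCharacteristic α N a c f₀) p ν :=
    .of_bound (hphase.congr (hν.ae_eq (ae_polyA_sub_spectralCharacteristic hform hpos)).symm)
      _ hbound
  simpa only [sub_sub_cancel] using (memLp_polyA N a p).sub hdiff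

lemma spectralCharacteristic_mem_minimaxSpace (hα : 1 ≤ α)
    (hform : ∀ᵐ θ ∂(volume.restrict (Set.Ioc (-Real.pi) Real.pi)), f₀ θ = C * ‖polyC N c θ‖)
    (hpos : ∀ᵐ θ ∂(volume.restrict (Set.Ioc (-Real.pi) Real.pi)), 0 < f₀ θ)
    (heq : ∀ k : ℕ, k ≤ N → ∫ θ in Set.Ioc (-Real.pi) Real.pi,
      Complex.exp (-(k * θ * Complex.I)) * spectralCharacteristic α N a c f₀ θ = 0) :
    spectralCharacteristic α N a c f₀ ∈ minimaxSpace α N (densityClass P) :=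
  Set.mem_iInter₂.2 fun f hf =>
    have := isFiniteMeasure_spectralMeasure hf.1
    mem_observedSpace_of_memLp hα hf.1 (memLp_spectralCharacteristic hform hpos
      (.add_left .rfl (spectralMeasure_absolutelyContinuous f)) _) heq

lemma ae_eq_or_estError_spectralCharacteristic_lt (hα : 1 < α)
    (hform : ∀ᵐ θ ∂(volume.restrict (Set.Ioc (-Real.pi) Real.pi)), f₀ θ = C * ‖polyC N c θ‖)
    (hclass : f₀ ∈ densityClass P)
    (hpos : ∀ᵐ θ ∂(volume.restrict (Set.Ioc (-Real.pi) Real.pi)), 0 < f₀ θ)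
    (hmem : spectralCharacteristic α N a c f₀ ∈ observedSpace α N f₀) {g : ℝ → ℂ}
    (hg : g ∈ observedSpace α N f₀) :
    g =ᵐ[spectralMeasure f₀] spectralCharacteristic α N a c f₀ ∨
      estError α N a (spectralCharacteristic α N a c f₀) f₀ < estError α N a g f₀ := by
  have hac := (spectralMeasure_absolutelyContinuous f₀).ae_le
  have hphase := hac (ae_norm_phaseC_eq_one hform hpos)
  refine ae_eq_or_estError_lt hα hclass.1 (measurable_phaseC N c).aestronglyMeasurable hphase
    (fun b hb => integral_trigSum_mul_phaseC hform hclass hb) hmem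
    (K := (C⁻¹ ^ (1 / (α - 1)) : ℝ)) ?_ hg
  filter_upwards [hac (ae_polyA_sub_spectralCharacteristic hform hpos), hphase] with θ hdiff hθ
  rw [hdiff, mul_assoc, Complex.conj_mul', hθ, Complex.ofReal_one, one_pow, mul_one]

end PhaseDensity

theorem _root_.mainTheorem6_general (α : ℝ) (hα₁ : 1 < α) (N : ℕ) (a c : ℕ → ℂ) (C P : ℝ)
    (f₀ : ℝ → ℝ)
    (hform : ∀ᵐ θ ∂(volume.restrict (Set.Ioc (-Real.pi) Real.pi)),
      f₀ θ = C * ‖polyC N c θ‖)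
    (hclass : f₀ ∈ densityClass P)
    (hpos : ∀ᵐ θ ∂(volume.restrict (Set.Ioc (-Real.pi) Real.pi)), 0 < f₀ θ)
    (heq : ∀ k : ℕ, k ≤ N →
      ∫ θ in Set.Ioc (-Real.pi) Real.pi, Complex.exp (-(k * θ * Complex.I)) *
        (polyA N a θ - signedPow
          (((f₀ θ)⁻¹ : ℝ) * polyC N c θ) (1 / (α - 1))) = 0) :
    IsOptimalCharacteristic α N a f₀
      (spectralCharacteristic α N a c f₀) ∧
    (∀ h : ℝ → ℂ, IsOptimalCharacteristic α N a f₀ h →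
      h =ᵐ[spectralMeasure f₀]
        spectralCharacteristic α N a c f₀) ∧
    IsLeastFavorable α N a (densityClass P) f₀ ∧
    IsMinimaxCharacteristic α N a (densityClass P)
      (spectralCharacteristic α N a c f₀) ∧
    (∀ f ∈ densityClass P,
      ∀ (Ω : Type*) [MeasurableSpace Ω] (Pr : Measure Ω) [IsProbabilityMeasure Pr]
        (ξ : ℤ → Ω → ℂ), IsHarmonizableStable α Pr ξ f →
      ∀ h ∈ observedSpace α N f, ∀ η : Ω → ℂ,
        IsLinearEstimate α N Pr ξ f h η →
        HasCovariationNormPow α Pr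
          (fun ω => functionalA N a ξ ω - η ω)
          (estError α N a h f)) := by
  set h₀ := spectralCharacteristic α N a c f₀
  have hmem : h₀ ∈ minimaxSpace α N (densityClass P) :=
    spectralCharacteristic_mem_minimaxSpace hα₁.le hform hpos heq
  have hmem₀ : h₀ ∈ observedSpace α N f₀ := Set.mem_iInter₂.1 hmem f₀ hclass
  have hstrict : ∀ g ∈ observedSpace α N f₀,
      g =ᵐ[spectralMeasure f₀] h₀ ∨ estError α N a h₀ f₀ < estError α N a g f₀ :=
    fun g hg => ae_eq_or_estError_spectralCharacteristic_lt hα₁ hform hclass hpos hmem₀ hg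
  have hopt : IsOptimalCharacteristic α N a f₀ h₀ :=
    ⟨hmem₀, fun g hg => (hstrict g hg).elim (fun h => (estError_congr h).ge) le_of_lt⟩
  have hequalizer : ∀ f ∈ densityClass P, estError α N a h₀ f = estError α N a h₀ f₀ := by
    have hnorm := ae_norm_polyA_sub_spectralCharacteristic (α := α) (a := a) hform hpos
    intro f hf
    rw [estError_eq_of_ae_norm_eq hnorm hf, estError_eq_of_ae_norm_eq hnorm hclass]
  have hsaddle := fun f hf => (hequalizer f hf).le
  exact ⟨hopt, fun h hh => (hstrict h hh.1).resolve_right (hh.2 h₀ hmem₀).not_gt,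
    hopt.isLeastFavorable hclass hmem hsaddle, hopt.isMinimaxCharacteristic hclass hmem hsaddle,
    fun f hf Ω _ Pr _ ξ hξ h hh η hη => hη.hasCovariationNormPow_sub hα₁.le a hf.1 hξ hh⟩

end StableInterpolation

theorem mainTheorem6 (α : ℝ) (hα₁ : 1 < α) (hα₂ : α ≤ 2) (N : ℕ) (a c : ℕ → ℂ) (C P : ℝ)
    (f₀ : ℝ → ℝ)
    (hform : ∀ᵐ θ ∂(volume.restrict (Set.Ioc (-Real.pi) Real.pi)),
      f₀ θ = C * ‖StableInterpolation.polyC N c θ‖)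
    (hclass : f₀ ∈ StableInterpolation.densityClass P)
    (hmin : StableInterpolation.Minimality α f₀)
    (heq : ∀ k : ℕ, k ≤ N →
      ∫ θ in Set.Ioc (-Real.pi) Real.pi, Complex.exp (-(k * θ * Complex.I)) *
        (StableInterpolation.polyA N a θ - StableInterpolation.signedPow
          (((f₀ θ)⁻¹ : ℝ) * StableInterpolation.polyC N c θ) (1 / (α - 1))) = 0) :
    -- the spectral characteristic `h(f₀)` is given by the formula, and it is unique
    StableInterpolation.IsOptimalCharacteristic α N a f₀
      (StableInterpolation.spectralCharacteristic α N a c f₀) ∧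
    (∀ h : ℝ → ℂ, StableInterpolation.IsOptimalCharacteristic α N a f₀ h →
      h =ᵐ[StableInterpolation.spectralMeasure f₀]
        StableInterpolation.spectralCharacteristic α N a c f₀) ∧
    -- `f₀` is least favorable and `h(f₀)` is minimax
    StableInterpolation.IsLeastFavorable α N a (StableInterpolation.densityClass P) f₀ ∧
    StableInterpolation.IsMinimaxCharacteristic α N a (StableInterpolation.densityClass P)
      (StableInterpolation.spectralCharacteristic α N a c f₀) ∧
    -- `Δ(h; f)` is the error of the estimate of `A_N ξ` with spectral characteristic `h`
    (∀ f ∈ StableInterpolation.densityClass P,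
      ∀ (Ω : Type*) [MeasurableSpace Ω] (Pr : Measure Ω) [IsProbabilityMeasure Pr]
        (ξ : ℤ → Ω → ℂ), StableInterpolation.IsHarmonizableStable α Pr ξ f →
      ∀ h ∈ StableInterpolation.observedSpace α N f, ∀ η : Ω → ℂ,
        StableInterpolation.IsLinearEstimate α N Pr ξ f h η →
        StableInterpolation.HasCovariationNormPow α Pr
          (fun ω => StableInterpolation.functionalA N a ξ ω - η ω)
          (StableInterpolation.estError α N a h f)) :=
  mainTheorem6_general α hα₁ N a c C P f₀ hform hclass
    (StableInterpolation.ae_pos_of_minimality hα₁ hclass.1.aemeasurable hmin) heq
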